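/- Let $\mathbb{F}_q$ be a finite field and let $L/\mathbb{F}_q$ be a finite extension of odd degree $d\ge 5$. Let $p\in\mathbb{F}_q[X]$ be monic irreducible, let $\gamma:\mathbb{F}_q[X]\to L$ be an $\mathbb{F}_q$-algebra morphism with kernel $(p)$, and let $m$ be the integer with $m\deg p=d$. Let $f=\alpha p^m$ with $\alpha\in\mathbb{F}_q^\times$, let $h\in\mathbb{F}_q[X]$ have degree at most $(d-1)/2$ and not be divisible by $p$, and put $\xi=Y^2+h(X)Y-f(X)$. Assume that the affine plane curve $\xi=0$ is smooth (so that it defines an imaginary hyperelliptic curve $\mathcal{H}$), and let $A_{\mathcal{H}}=\mathbb{F}_q[X][Y]/(\xi)$. Let $L\{\tau\}$ be the ring of Ore polynomials $\sum_i a_i\tau^i$, $a_i\in L$, with $\tau a=a^q\tau$, and let $\tau_L=\tau^d$. A Drinfeld $\mathbb{F}_q[X]$-module over $L$ is an $\mathbb{F}_q$-algebra morphism $\phi:a\mapsto\phi_a$ from $\mathbb{F}_q[X]$ to $L\{\tau\}$ such that $\phi_a$ has constant coefficient $\gamma(a)$ for all $a$ and $\deg_\tau(\phi_a)>0$ for some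 $a$; it has rank $r$ if $\deg_\tau(\phi_a)=r\deg(a)$ for all nonzero $a$. Let $\mathrm{Hom}(\phi,\psi)$ be the set of $\iota\in L\{\tau\}$ with $\iota\phi_a=\psi_a\iota$ for all $a$, let $\mathrm{End}(\phi)=\mathrm{Hom}(\phi,\phi)$, and call the nonzero elements of $\mathrm{Hom}(\phi,\psi)$ isogenies $\phi\to\psi$. Let $\mathrm{Dr}_2(\mathbb{F}_q[X],L)_\xi$ be the set of rank-$2$ Drinfeld $\mathbb{F}_q[X]$-modules $\phi$ over $L$ whose characteristic polynomial of the Frobenius endomorphism is $\xi$, that is, $\xi(\phi_X,\tau_L)=0$ (with $\deg f=d$ and $\deg h\le d/2$). Since $p\nmid h$, all of them are ordinary. (1) For every $\phi\in\mathrm{Dr}_2(\mathbb{F}_q[X],L)_\xi$, the map $g\mapsto g(\phi_X,\tau_L)$ is a ring isomorphism $A_{\mathcal{H}}\to\mathrm{End}(\phi)$. Under this identification, the map which sends a monic isogeny $\iota:\phi\to\psi$, where $\psi$ is any Drinfeld $\mathbb{F}_q[X]$-module over $L$, to $\mathrm{Hom}(\psi,\phi)\,\iota\subset\mathrm{End}(\phi)\simeq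 A_{\mathcal{H}}$ is a bijection from the set of monic isogenies with domain $\phi$ onto the set of nonzero ideals of $A_{\mathcal{H}}$. (2) Let $\phi_1,\phi_2,\phi_3\in\mathrm{Dr}_2(\mathbb{F}_q[X],L)_\xi$ and let $\iota_1:\phi_1\to\phi_2$, $\iota_2:\phi_2\to\phi_3$ be isogenies (not necessarily monic). Then the ideal of $A_{\mathcal{H}}$ associated to $\iota_2\iota_1$, i.e. the one corresponding to $\mathrm{Hom}(\phi_3,\phi_1)\,\iota_2\iota_1$, is the product of the ideals of $A_{\mathcal{H}}$ associated to $\iota_1$ and to $\iota_2$, i.e. those corresponding to $\mathrm{Hom}(\phi_2,\phi_1)\,\iota_1\subset\mathrm{End}(\phi_1)$ and $\mathrm{Hom}(\phi_3,\phi_2)\,\iota_2\subset\mathrm{End}(\phi_2)$. -/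

import Mathlib

open Polynomial

/-- A copy of `L` (an `F`-algebra, with `F` a finite field with `q` elements) on which
`Multiplicative ℕ` acts through the powers of the `q`-Frobenius `x ↦ x ^ q`. -/
@[nolint unusedArguments]
def Twisted (_F L : Type*) : Type _ := L

section Ore

variable (F L : Type*) [Field F] [Fintype F] [Field L] [Algebra F L]

instance Twisted.instField : Field (Twisted F L) := inferInstanceAs (Field L)

instance Twisted.instAlgebra : Algebra F (Twisted F L) := inferInstanceAs (Algebra F L)

/-- `n` acts as `x ↦ x ^ (q ^ n)`, see `Twisted.smul_eq_pow`. -/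
noncomputable instance Twisted.instAction : MulSemiringAction (Multiplicative ℕ) (Twisted F L) where
  smul n x := (FiniteField.frobeniusAlgHom F (Twisted F L) ^ Multiplicative.toAdd n) x
  one_smul x := by
    change (FiniteField.frobeniusAlgHom F (Twisted F L) ^ 0) x = x
    rw [pow_zero, AlgHom.one_apply]
  mul_smul m n x := by
    change (FiniteField.frobeniusAlgHom F (Twisted F L) ^
      (Multiplicative.toAdd m + Multiplicative.toAdd n)) x = _
    rw [pow_add, AlgHom.mul_apply]
    rfl
  smul_zero n := map_zero _
  smul_add n := map_add _
  smul_one n := map_one _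
  smul_mul n := map_mul _

theorem Twisted.smul_eq_pow (n : Multiplicative ℕ) (x : Twisted F L) :
    n • x = x ^ (Fintype.card F ^ Multiplicative.toAdd n) := by
  change ((FiniteField.frobeniusAlgHom F (Twisted F L)) ^ (Multiplicative.toAdd n)) x = _
  rw [AlgHom.coe_pow]
  change (fun y : Twisted F L => y ^ Fintype.card F)^[Multiplicative.toAdd n] x = _
  exact congrFun (pow_iterate (Fintype.card F) (Multiplicative.toAdd n)) x

instance Twisted.instSMulCommClass :
    SMulCommClass (Multiplicative ℕ) F (Twisted F L) where
  smul_comm n c x :=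
    map_smul ((FiniteField.frobeniusAlgHom F (Twisted F L)) ^ (Multiplicative.toAdd n)) c x

/-- The `F`-algebra `L{τ}` of Ore polynomials `∑ aᵢ τⁱ` with `aᵢ ∈ L` and `τ a = a ^ q τ`. -/
abbrev Ore : Type _ := SkewPolynomial (Twisted F L)

variable {F L}

namespace Ore

/-- The `τ`-degree (`0` for the zero polynomial). -/
def tauDegree (P : Ore F L) : ℕ := P.support.sup id

/-- An Ore polynomial is monic if its leading coefficient is `1`. -/
def Monic (P : Ore F L) : Prop := SkewPolynomial.coeff P (tauDegree P) = 1

variable (F L) in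
/-- The Frobenius `τ_L = τ ^ [L : F]`. -/
noncomputable def tauL : Ore F L := SkewPolynomial.X ^ Module.finrank F L

theorem tauL_mul [FiniteDimensional F L] (P : Ore F L) : tauL F L * P = P * tauL F L := by
  have : Finite L := Module.finite_of_finite F
  have : Fintype L := Fintype.ofFinite L
  have key : ∀ x : Twisted F L, (SkewPolynomial.φ)^[Module.finrank F L] x = x := by
    intro x
    rw [SkewPolynomial.φ_iterate_apply, Twisted.smul_eq_pow, _root_.toAdd_ofAdd,
      ← Module.card_eq_pow_finrank (K := F) (V := L)]
    exact FiniteField.pow_card (K := L) x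
  rw [tauL, SkewPolynomial.X_pow_mul]
  simp only [key, SkewPolynomial.sum_monomial]

end Ore

end Ore

section Drinfeld

variable {F L : Type*} [Field F] [Fintype F] [Field L] [Algebra F L]

/-- A Drinfeld `F[X]`-module over `L`, where `L` is an `F[X]`-field through `γ`. -/
@[ext]
structure DrinfeldModule (γ : F[X] →ₐ[F] L) where
  /-- the structure map `a ↦ φ_a` -/
  toAlgHom : F[X] →ₐ[F] Ore F L
  coeff_zero : ∀ a, SkewPolynomial.coeff (toAlgHom a) 0 = (γ a : L)
  exists_tauDegree_pos : ∃ a, 0 < (toAlgHom a).tauDegree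

namespace DrinfeldModule

variable {γ : F[X] →ₐ[F] L}

noncomputable instance instCoeFun : CoeFun (DrinfeldModule γ) (fun _ => F[X] → Ore F L) :=
  ⟨fun φ => φ.toAlgHom⟩

/-- `φ` has rank `r`: `deg_τ φ_a = r * deg a` for all `a`. -/
def HasRank (φ : DrinfeldModule γ) (r : ℕ) : Prop :=
  ∀ a : F[X], (φ a).tauDegree = r * a.natDegree

/-- The morphisms `φ → ψ`: the Ore polynomials `ι` with `ι φ_a = ψ_a ι` for all `a`. -/
noncomputable def Hom (φ ψ : DrinfeldModule γ) : Submodule F (Ore F L) where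
  carrier := {ι | ∀ a : F[X], ι * φ a = ψ a * ι}
  add_mem' hx hy a := by rw [add_mul, mul_add, hx a, hy a]
  zero_mem' a := by rw [zero_mul, mul_zero]
  smul_mem' c x hx a := by rw [smul_mul_assoc, mul_smul_comm, hx a]

/-- Isogenies are the nonzero morphisms. -/
def IsIsogeny (φ ψ : DrinfeldModule γ) (ι : Ore F L) : Prop := ι ∈ Hom φ ψ ∧ ι ≠ 0

/-- The monic isogenies with domain `φ`, each recorded together with its codomain. -/
def monicIsogenies (φ : DrinfeldModule γ) : Set (DrinfeldModule γ × Ore F L) :=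
  {x | x.2.Monic ∧ IsIsogeny φ x.1 x.2}

end DrinfeldModule

/-- The polynomial `ξ = Y² + h(X) Y - f(X)` of `F[X][Y]`. -/
noncomputable def xi (h f : F[X]) : F[X][X] := X ^ 2 + C h * X - C f

/-- The ring `A_H = F[X][Y] / (ξ)`. -/
abbrev AH (h f : F[X]) : Type _ := AdjoinRoot (xi h f)

/-- The affine plane curve `y² + h(x) y = f(x)` has no singular point over an algebraic closure. -/
def IsSmoothAffineCurve (h f : F[X]) : Prop :=
  ∀ x y : AlgebraicClosure F, y ^ 2 + aeval x h * y - aeval x f = 0 →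
    ¬ (2 * y + aeval x h = 0 ∧ aeval x (derivative h) * y - aeval x (derivative f) = 0)

namespace DrinfeldModule

variable {γ : F[X] →ₐ[F] L} {h f : F[X]}

/-- `ξ = Y² + h(X) Y - f(X)` is the characteristic polynomial of the Frobenius endomorphism of
the rank-two module `φ`: `ξ(φ_X, τ_L) = 0`, `deg f = [L : F]` and `deg h ≤ [L : F] / 2`. -/
def IsFrobeniusCharpoly (φ : DrinfeldModule γ) (h f : F[X]) : Prop :=
  (xi h f).eval₂ (φ.toAlgHom : F[X] →+* Ore F L) (Ore.tauL F L) = 0 ∧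
    f.natDegree = Module.finrank F L ∧ 2 * h.natDegree ≤ Module.finrank F L

/-- The rank-two Drinfeld `F[X]`-modules over `L` whose characteristic polynomial of the Frobenius
endomorphism is `Y² + h(X) Y - f(X)`. -/
structure Rank2 (γ : F[X] →ₐ[F] L) (h f : F[X]) extends DrinfeldModule γ where
  hasRank : toDrinfeldModule.HasRank 2
  isFrobeniusCharpoly : toDrinfeldModule.IsFrobeniusCharpoly h f

variable [FiniteDimensional F L]

/-- The ring morphism `F[X][Y] → L{τ}`, `g ↦ g(φ_X, τ_L)`. -/
noncomputable def polyEval (φ : DrinfeldModule γ) : F[X][X] →+* Ore F L :=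
  Polynomial.eval₂RingHom' (φ.toAlgHom : F[X] →+* Ore F L) (Ore.tauL F L)
    fun a => (Ore.tauL_mul (φ.toAlgHom a)).symm

/-- The ring morphism `A_H → L{τ}`, `g ↦ g(φ_X, τ_L)`. -/
noncomputable def Rank2.eval (φ : Rank2 γ h f) : AH h f →+* Ore F L :=
  Ideal.Quotient.lift (Ideal.span {xi h f}) φ.toDrinfeldModule.polyEval (by
    intro a ha
    obtain ⟨b, rfl⟩ := Ideal.mem_span_singleton.mp ha
    have h0 : φ.toDrinfeldModule.polyEval (xi h f) = 0 := φ.isFrobeniusCharpoly.1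
    rw [map_mul, h0, zero_mul])

theorem Rank2.eval_root (φ : Rank2 γ h f) : φ.eval (AdjoinRoot.root (xi h f)) = Ore.tauL F L := by
  change φ.toDrinfeldModule.polyEval X = _
  exact Polynomial.eval₂_X _ _

theorem Rank2.eval_of (φ : Rank2 γ h f) (a : F[X]) :
    φ.eval (AdjoinRoot.of (xi h f) a) = φ.toDrinfeldModule a := by
  change φ.toDrinfeldModule.polyEval (C a) = _
  exact Polynomial.eval₂_C _ _

theorem Rank2.eval_mem_hom (φ : Rank2 γ h f) (b : AH h f) :
    φ.eval b ∈ Hom φ.toDrinfeldModule φ.toDrinfeldModule := by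
  intro a
  rw [← φ.eval_of, ← map_mul, ← map_mul, mul_comm]

/-- The ideal of `A_H` that corresponds to `Hom(ψ, φ) ι ⊆ End(φ)` under
`A_H → End(φ)`, `g ↦ g(φ_X, τ_L)`. -/
noncomputable def Rank2.idealOf (φ : Rank2 γ h f) (ψ : DrinfeldModule γ) (ι : Ore F L) :
    Ideal (AH h f) where
  carrier := {a | ∃ g ∈ Hom ψ φ.toDrinfeldModule, φ.eval a = g * ι}
  add_mem' := by
    rintro a b ⟨g, hg, ha⟩ ⟨g', hg', hb⟩
    exact ⟨g + g', add_mem hg hg', by rw [map_add, ha, hb, add_mul]⟩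
  zero_mem' := ⟨0, zero_mem _, by rw [map_zero, zero_mul]⟩
  smul_mem' := by
    rintro c a ⟨g, hg, ha⟩
    refine ⟨φ.eval c * g, fun x => ?_, by rw [smul_eq_mul, map_mul, ha, mul_assoc]⟩
    rw [mul_assoc, hg x, ← mul_assoc, φ.eval_mem_hom c x, mul_assoc]

end DrinfeldModule

end Drinfeld

/-! Write `I_ι` for the ideal of an isogeny `ι`, `q = |F|` and `d = [L : F]`. Since `d` is odd,
nonzero `φ_a` has even `τ`-degree and nonzero `φ_b τ_L` odd degree, so they cannot cancel: `A_H`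
embeds in `L{τ}` and is a domain. Smoothness makes it integrally closed, hence Dedekind
(`AH.isDedekindDomain`). Two endomorphisms of equal positive degree have leading coefficients whose
ratio lies in `L ∩ F_{q²} = F`, and `A_H` realises every degree above `d`, so `End(φ)/A_H` is
finite. Every endomorphism is then a fraction of elements of `A_H` that is integral over `A_H`,
hence lies in `A_H` (`range_eval`).

The ideals are controlled by the index formula `|A_H / I_ι| = q ^ deg ι` (`card_quotient_idealOf`).
For `≤`, if `ι` is separable then `I_ι` is the annihilator of its kernel, which has `q ^ deg ι`
elements, and a finite module over a Dedekind domain is at least as large as the ring modulo the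
annihilator; otherwise a factor `τ ^ deg p` splits off, whose ideal contains `p` and `Y`. For `≥`,
complete `ι` to `φ_a = g ι` with `a ≠ 0`: then `I_ι I_g ⊆ (a)`, and `(a)` has index `q ^ (2 deg a) =
q ^ (deg g + deg ι)`, so both upper bounds are sharp.

Multiplicativity follows because the inclusion `I_ι₁ I_ι₂ ⊆ I_(ι₂ι₁)` is formal and the two indices
agree. For the bijection, the left ideal `L{τ} I` is principal and its monic generator is an
isogeny; its ideal is `I`, by cancelling an ideal `J` with `I J` principal
(`exists_monic_isIsogeny`). A monic isogeny with ideal `I` divides that generator on the right and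
has the same degree by the index formula, so it is the generator. -/

set_option linter.unusedSectionVars false

/-! ### Ore polynomials: coefficients, degree, left principal ideals -/

namespace Ore

section Basic

variable {F L : Type*} [Field F] [Fintype F] [Field L] [Algebra F L]

theorem iterate_φ_eq_pow (n : ℕ) (x : Twisted F L) :
    (SkewPolynomial.φ)^[n] x = x ^ (Fintype.card F ^ n) := by
  rw [SkewPolynomial.φ_iterate_apply, Twisted.smul_eq_pow, _root_.toAdd_ofAdd]

theorem add_pow_card_pow (n : ℕ) (x y : Twisted F L) :
    (x + y) ^ (Fintype.card F ^ n) = x ^ (Fintype.card F ^ n) + y ^ (Fintype.card F ^ n) := by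
  have := smul_add (Multiplicative.ofAdd n : Multiplicative ℕ) x y
  simpa only [Twisted.smul_eq_pow, _root_.toAdd_ofAdd] using this

theorem card_pow_ne_zero (n : ℕ) : Fintype.card F ^ n ≠ 0 :=
  pow_ne_zero _ Fintype.card_ne_zero

@[simp]
theorem coeff_zero' (n : ℕ) : SkewPolynomial.coeff (0 : Ore F L) n = 0 := rfl

@[simp]
theorem coeff_sub (P Q : Ore F L) (n : ℕ) :
    SkewPolynomial.coeff (P - Q) n = SkewPolynomial.coeff P n - SkewPolynomial.coeff Q n := by
  have := SkewPolynomial.coeff_add (P - Q) Q n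
  rw [sub_add_cancel] at this
  rw [this, add_sub_cancel_right]

@[simp]
theorem coeff_smul (c : F) (P : Ore F L) (n : ℕ) :
    SkewPolynomial.coeff (c • P) n = c • SkewPolynomial.coeff P n := rfl

theorem coeff_monomial_mul (a : ℕ) (r : Twisted F L) (Q : Ore F L) (n : ℕ) :
    SkewPolynomial.coeff (SkewPolynomial.monomial a r * Q : Ore F L) n =
      if a ≤ n then r * SkewPolynomial.coeff Q (n - a) ^ (Fintype.card F ^ a) else 0 := by
  induction Q using SkewPolynomial.induction with
  | h0 => simp
  | ha b s Q _ _ ih =>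
    rw [mul_add, SkewPolynomial.coeff_add, ih, SkewPolynomial.monomial_mul_monomial,
      SkewPolynomial.coeff_monomial, SkewPolynomial.coeff_add, SkewPolynomial.coeff_monomial,
      iterate_φ_eq_pow, add_pow_card_pow]
    by_cases h : a ≤ n
    · have : a + b = n ↔ b = n - a := by omega
      by_cases h' : b = n - a <;> simp [h, this, h', mul_add]
    · have : a + b ≠ n := by omega
      simp [h, this]

theorem coeff_mul (P Q : Ore F L) (n : ℕ) :
    SkewPolynomial.coeff (P * Q) n = ∑ x ∈ Finset.HasAntidiagonal.antidiagonal n,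
      SkewPolynomial.coeff P x.1 * SkewPolynomial.coeff Q x.2 ^ (Fintype.card F ^ x.1) := by
  induction P using SkewPolynomial.induction with
  | h0 => simp
  | ha a r P _ _ ih =>
    rw [add_mul, SkewPolynomial.coeff_add, ih, coeff_monomial_mul]
    simp only [SkewPolynomial.coeff_add, add_mul, Finset.sum_add_distrib]
    congr 1
    simp only [SkewPolynomial.coeff_monomial, ite_mul, zero_mul]
    split_ifs with h
    · rw [Finset.sum_eq_single (a, n - a)]
      · simp
      · rintro ⟨i, j⟩ hij hne
        rw [Finset.HasAntidiagonal.mem_antidiagonal] at hij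
        rw [if_neg]
        rintro rfl
        apply hne
        simp only at hij
        ext <;> simp; omega
      · intro h'
        exact absurd (Finset.HasAntidiagonal.mem_antidiagonal.mpr (by simp [h])) h'
    · symm
      apply Finset.sum_eq_zero
      rintro ⟨i, j⟩ hij
      rw [Finset.HasAntidiagonal.mem_antidiagonal] at hij
      rw [if_neg]
      rintro rfl
      simp only at hij
      omega

theorem le_tauDegree {P : Ore F L} {n : ℕ} (h : SkewPolynomial.coeff P n ≠ 0) :
    n ≤ P.tauDegree :=
  Finset.le_sup (f := id) (SkewPolynomial.mem_support_iff.mpr h)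

theorem coeff_eq_zero {P : Ore F L} {n : ℕ} (h : P.tauDegree < n) :
    SkewPolynomial.coeff P n = 0 := by
  by_contra h'
  exact absurd (le_tauDegree h') (by omega)

theorem tauDegree_le {P : Ore F L} {N : ℕ} (h : ∀ n, N < n → SkewPolynomial.coeff P n = 0) :
    P.tauDegree ≤ N := by
  refine Finset.sup_le fun n hn => ?_
  by_contra h'
  exact SkewPolynomial.mem_support_iff.mp hn (h n (not_le.mp h'))

theorem tauDegree_zero : (0 : Ore F L).tauDegree = 0 := by
  simp [tauDegree]

theorem coeff_tauDegree_ne_zero {P : Ore F L} (h : P ≠ 0) :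
    SkewPolynomial.coeff P P.tauDegree ≠ 0 := by
  have hne : P.support.Nonempty := by
    rw [Finset.nonempty_iff_ne_empty]
    simpa using h
  obtain ⟨n, hn, hn'⟩ := Finset.exists_mem_eq_sup _ hne (id : ℕ → ℕ)
  rw [tauDegree, hn']
  exact SkewPolynomial.mem_support_iff.mp hn

theorem tauDegree_eq {P : Ore F L} {N : ℕ} (h : SkewPolynomial.coeff P N ≠ 0)
    (h' : ∀ n, N < n → SkewPolynomial.coeff P n = 0) : P.tauDegree = N :=
  le_antisymm (tauDegree_le h') (le_tauDegree h)

theorem tauDegree_lt {P : Ore F L} {N : ℕ} (hN : 0 < N)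
    (h : ∀ n, N ≤ n → SkewPolynomial.coeff P n = 0) : P.tauDegree < N := by
  have : P.tauDegree ≤ N - 1 := tauDegree_le fun n hn => h n (by omega)
  omega

theorem coeff_mul_add_of_le {P Q : Ore F L} {a b : ℕ} (hP : P.tauDegree ≤ a)
    (hQ : Q.tauDegree ≤ b) : SkewPolynomial.coeff (P * Q) (a + b) =
      SkewPolynomial.coeff P a * SkewPolynomial.coeff Q b ^ (Fintype.card F ^ a) := by
  rw [coeff_mul, Finset.sum_eq_single (a, b)]
  · rintro ⟨i, j⟩ hij hne
    rw [Finset.HasAntidiagonal.mem_antidiagonal] at hij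
    simp only at hij ⊢
    rcases lt_trichotomy i a with h | h | h
    · rw [coeff_eq_zero (P := Q) (n := j) (by omega), zero_pow (card_pow_ne_zero _), mul_zero]
    · exact absurd (Prod.ext h (by simp; omega)) hne
    · rw [coeff_eq_zero (P := P) (n := i) (by omega), zero_mul]
  · intro h
    exact absurd (Finset.HasAntidiagonal.mem_antidiagonal.mpr (by simp)) h

/-- Lowest terms multiply like leading terms. With `a = 0` or `b = 0` this compares constant
coefficients across `ι φ_a = ψ_a ι`. -/
theorem coeff_mul_add_of_vanish {P Q : Ore F L} {a b : ℕ}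
    (hP : ∀ i < a, SkewPolynomial.coeff P i = 0) (hQ : ∀ i < b, SkewPolynomial.coeff Q i = 0) :
    SkewPolynomial.coeff (P * Q) (a + b) =
      SkewPolynomial.coeff P a * SkewPolynomial.coeff Q b ^ (Fintype.card F ^ a) := by
  rw [coeff_mul, Finset.sum_eq_single (a, b)]
  · rintro ⟨i, j⟩ hij hne
    rw [Finset.HasAntidiagonal.mem_antidiagonal] at hij
    simp only at hij ⊢
    rcases lt_trichotomy i a with h | h | h
    · rw [hP i h, zero_mul]
    · exact absurd (Prod.ext h (by simp; omega)) hne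
    · rw [hQ j (by omega), zero_pow (card_pow_ne_zero _), mul_zero]
  · intro h
    exact absurd (Finset.HasAntidiagonal.mem_antidiagonal.mpr (by simp)) h

theorem coeff_mul_of_vanish_left {P : Ore F L} (Q : Ore F L) {a : ℕ}
    (hP : ∀ i < a, SkewPolynomial.coeff P i = 0) :
    ∀ i < a, SkewPolynomial.coeff (P * Q) i = 0 := by
  intro n hn
  rw [coeff_mul]
  refine Finset.sum_eq_zero fun x hx => ?_
  rw [Finset.HasAntidiagonal.mem_antidiagonal] at hx
  rw [hP _ (by omega), zero_mul]

theorem coeff_mul_of_vanish_right (P : Ore F L) {Q : Ore F L} {a : ℕ}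
    (hQ : ∀ i < a, SkewPolynomial.coeff Q i = 0) :
    ∀ i < a, SkewPolynomial.coeff (P * Q) i = 0 := by
  intro n hn
  rw [coeff_mul]
  refine Finset.sum_eq_zero fun x hx => ?_
  rw [Finset.HasAntidiagonal.mem_antidiagonal] at hx
  rw [hQ _ (by omega), zero_pow (card_pow_ne_zero _), mul_zero]

instance : Nontrivial (Ore F L) :=
  ⟨⟨0, 1, fun h => zero_ne_one (α := Twisted F L) (by
    simpa using congrArg (SkewPolynomial.coeff · 0) h)⟩⟩

instance : NoZeroDivisors (Ore F L) where
  eq_zero_or_eq_zero_of_mul_eq_zero {P Q} h := by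
    by_contra! hne
    have := coeff_mul_add_of_le (le_refl P.tauDegree) (le_refl Q.tauDegree)
    rw [h, coeff_zero'] at this
    exact mul_ne_zero (coeff_tauDegree_ne_zero hne.1)
      (pow_ne_zero _ (coeff_tauDegree_ne_zero hne.2)) this.symm

instance : IsDomain (Ore F L) := NoZeroDivisors.to_isDomain _

theorem tauDegree_mul {P Q : Ore F L} (hP : P ≠ 0) (hQ : Q ≠ 0) :
    (P * Q).tauDegree = P.tauDegree + Q.tauDegree := by
  refine tauDegree_eq ?_ fun n hn => ?_
  · rw [coeff_mul_add_of_le le_rfl le_rfl]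
    exact mul_ne_zero (coeff_tauDegree_ne_zero hP) (pow_ne_zero _ (coeff_tauDegree_ne_zero hQ))
  · obtain ⟨k, rfl⟩ := Nat.exists_eq_add_of_lt hn
    rw [show P.tauDegree + Q.tauDegree + k + 1 = (P.tauDegree + k + 1) + Q.tauDegree by ring,
      coeff_mul_add_of_le (by omega) le_rfl, coeff_eq_zero (by omega), zero_mul]

theorem tauDegree_monomial {n : ℕ} {r : Twisted F L} (hr : r ≠ 0) :
    tauDegree (SkewPolynomial.monomial n r : Ore F L) = n :=
  tauDegree_eq (by simpa [SkewPolynomial.coeff_monomial] using hr) fun k hk => by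
    rw [SkewPolynomial.coeff_monomial, if_neg (by omega)]

theorem monomial_ne_zero {n : ℕ} {r : Twisted F L} (hr : r ≠ 0) :
    (SkewPolynomial.monomial n r : Ore F L) ≠ 0 := by
  simpa using hr

theorem X_pow_eq (n : ℕ) :
    (SkewPolynomial.X ^ n : Ore F L) = SkewPolynomial.monomial n 1 :=
  SkewPolynomial.X_pow_eq_monomial n

theorem tauDegree_X_pow (n : ℕ) : (SkewPolynomial.X ^ n : Ore F L).tauDegree = n := by
  rw [X_pow_eq, tauDegree_monomial one_ne_zero]

theorem X_pow_ne_zero (n : ℕ) : (SkewPolynomial.X ^ n : Ore F L) ≠ 0 := by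
  rw [X_pow_eq]
  exact monomial_ne_zero one_ne_zero

/-- A nonzero Ore polynomial has an order in `τ`. -/
theorem exists_order {P : Ore F L} (hP : P ≠ 0) : ∃ k, SkewPolynomial.coeff P k ≠ 0 ∧
    ∀ i < k, SkewPolynomial.coeff P i = 0 := by
  classical
  have h : ∃ k, SkewPolynomial.coeff P k ≠ 0 := ⟨_, coeff_tauDegree_ne_zero hP⟩
  exact ⟨Nat.find h, Nat.find_spec h, fun i hi => not_not.mp (Nat.find_min h hi)⟩

/-- Multiplication by `τ` on the right only shifts coefficients, with no twist, so no roots have to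
be extracted in `L`. -/
theorem exists_eq_mul_X_pow (P : Ore F L) (k : ℕ)
    (h : ∀ i < k, SkewPolynomial.coeff P i = 0) :
    ∃ Q : Ore F L, P = Q * SkewPolynomial.X ^ k := by
  have : P = (∑ n ∈ P.support, SkewPolynomial.monomial (n - k) (SkewPolynomial.coeff P n)) *
      SkewPolynomial.X ^ k := by
    conv_lhs => rw [← SkewPolynomial.sum_monomial P, SkewPolynomial.sum_def]
    rw [Finset.sum_mul]
    refine Finset.sum_congr rfl fun n hn => ?_
    have hk : k ≤ n := by
      by_contra hlt
      exact SkewPolynomial.mem_support_iff.mp hn (h n (not_le.mp hlt))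
    rw [SkewPolynomial.monomial_mul_X_pow, Nat.sub_add_cancel hk]
  exact ⟨_, this⟩

/-- Division with remainder, with the quotient on the left. -/
theorem exists_eq_mul_add {D : Ore F L} (hD : D ≠ 0) (P : Ore F L) :
    ∃ Q R : Ore F L, P = Q * D + R ∧ (R = 0 ∨ R.tauDegree < D.tauDegree) := by
  induction hN : P.tauDegree using Nat.strong_induction_on generalizing P with
  | _ N ih =>
  by_cases hlt : N < D.tauDegree
  · exact ⟨0, P, by simp, Or.inr (hN ▸ hlt)⟩
  push Not at hlt
  by_cases hP : P = 0
  · exact ⟨0, 0, by simp [hP], Or.inl rfl⟩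
  set k := N - D.tauDegree
  set c : Twisted F L := SkewPolynomial.coeff P N /
    SkewPolynomial.coeff D D.tauDegree ^ (Fintype.card F ^ k)
  have hDlead := pow_ne_zero (Fintype.card F ^ k) (coeff_tauDegree_ne_zero hD)
  have hc : c ≠ 0 := div_ne_zero (hN ▸ coeff_tauDegree_ne_zero hP) hDlead
  set M : Ore F L := SkewPolynomial.monomial k c
  have hMdeg : M.tauDegree = k := tauDegree_monomial hc
  have hMD : (M * D).tauDegree = N := by
    rw [tauDegree_mul (monomial_ne_zero hc) hD, hMdeg]
    omega
  have hcoef : ∀ n, N ≤ n → SkewPolynomial.coeff (P - M * D) n = 0 := by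
    intro n hn
    rcases hn.eq_or_lt with rfl | hn
    · rw [coeff_sub]
      have h1 := coeff_mul_add_of_le hMdeg.le (le_refl D.tauDegree)
      rw [show k + D.tauDegree = N by omega] at h1
      rw [h1, SkewPolynomial.coeff_monomial, if_pos rfl, div_mul_cancel₀ _ hDlead, sub_self]
    · rw [coeff_sub, coeff_eq_zero (by omega), coeff_eq_zero (by omega), sub_zero]
  -- The zero polynomial has degree `0` by convention, so at `N = 0` the degree cannot drop and the
  -- difference is shown to vanish instead.
  by_cases h0 : N = 0
  · refine ⟨M, 0, ?_, Or.inl rfl⟩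
    rw [add_zero, ← sub_eq_zero]
    ext n
    exact hcoef n (by omega)
  · obtain ⟨Q, R, hQR, hR⟩ := ih _ (tauDegree_lt (by omega) hcoef) (P - M * D) rfl
    refine ⟨M + Q, R, ?_, hR⟩
    rw [add_mul, add_assoc, ← hQR]
    abel

theorem eq_C_of_tauDegree_eq_zero {P : Ore F L} (h : P.tauDegree = 0) :
    P = SkewPolynomial.C (SkewPolynomial.coeff P 0) := by
  ext n
  rw [SkewPolynomial.coeff_C]
  split_ifs with hn
  · rw [hn]
  · exact coeff_eq_zero (by omega)

theorem Monic.ne_zero {P : Ore F L} (h : P.Monic) : P ≠ 0 := by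
  rintro rfl
  rw [Monic, coeff_zero'] at h
  exact zero_ne_one h

theorem Monic.eq_of_eq_mul {P Q M : Ore F L} (hP : P.Monic) (hQ : Q.Monic) (h : P = M * Q)
    (hdeg : P.tauDegree = Q.tauDegree) : P = Q := by
  have hM : M ≠ 0 := by
    rintro rfl
    exact hP.ne_zero (by simpa using h)
  have hM0 : M.tauDegree = 0 := by
    have := tauDegree_mul hM hQ.ne_zero
    rw [← h] at this
    omega
  have h1 := coeff_mul_add_of_le hM0.le (le_refl Q.tauDegree)
  rw [← h, zero_add, ← hdeg, hP, hdeg, hQ, one_pow, mul_one] at h1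
  rw [h, eq_C_of_tauDegree_eq_zero hM0, ← h1, SkewPolynomial.C_1, one_mul]

/-- Left ideals of `L{τ}` are principal, generated by a monic element. -/
theorem exists_monic_generator (N : Ideal (Ore F L)) (hN : N ≠ ⊥) :
    ∃ P ∈ N, P.Monic ∧ ∀ Q ∈ N, ∃ M, Q = M * P := by
  classical
  obtain ⟨P₀, hP₀, hP₀'⟩ := Submodule.exists_mem_ne_zero_of_ne_bot hN
  have hex : ∃ n, ∃ P ∈ N, P ≠ 0 ∧ P.tauDegree = n := ⟨_, P₀, hP₀, hP₀', rfl⟩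
  obtain ⟨P, hPN, hP, hdeg⟩ := Nat.find_spec hex
  have hmin : ∀ Q ∈ N, Q ≠ 0 → P.tauDegree ≤ Q.tauDegree := fun Q hQ hQ0 =>
    hdeg ▸ Nat.find_min' hex ⟨Q, hQ, hQ0, rfl⟩
  set c : Twisted F L := (SkewPolynomial.coeff P P.tauDegree)⁻¹
  have hlead := coeff_tauDegree_ne_zero hP
  have hc : c ≠ 0 := inv_ne_zero hlead
  have hC : (SkewPolynomial.monomial 0 c : Ore F L) ≠ 0 := monomial_ne_zero hc
  have hCdeg : tauDegree (SkewPolynomial.monomial 0 c : Ore F L) = 0 := tauDegree_monomial hc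
  have hdeg' : tauDegree (SkewPolynomial.monomial 0 c * P : Ore F L) = P.tauDegree := by
    rw [tauDegree_mul hC hP, hCdeg, zero_add]
  have hmem : (SkewPolynomial.monomial 0 c * P : Ore F L) ∈ N := N.mul_mem_left _ hPN
  refine ⟨SkewPolynomial.monomial 0 c * P, hmem, ?_, fun Q hQ => ?_⟩
  · rw [Monic, hdeg']
    have h1 := coeff_mul_add_of_le hCdeg.le (le_refl P.tauDegree)
    rw [zero_add] at h1
    rw [h1, SkewPolynomial.coeff_monomial, if_pos rfl, pow_zero, pow_one]
    exact inv_mul_cancel₀ hlead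
  · obtain ⟨M, R, hQR, hR⟩ := exists_eq_mul_add (mul_ne_zero hC hP) Q
    have hRN : R ∈ N := by
      rw [show R = Q - M * (SkewPolynomial.monomial 0 c * P) by rw [hQR]; abel]
      exact sub_mem hQ (N.mul_mem_left _ hmem)
    refine ⟨M, ?_⟩
    have : R = 0 := by
      by_contra hR0
      have := hmin R hRN hR0
      rcases hR with hR | hR
      · exact hR0 hR
      · omega
    rw [hQR, this, add_zero]

end Basic

end Ore

/-! ### Ore polynomials as additive maps on an extension of `L` -/

namespace Ore

section Action

variable {F L : Type*} [Field F] [Fintype F] [Field L] [Algebra F L]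
variable (K : Type*) [Field K] [Algebra F K] [Algebra L K] [IsScalarTower F L K]

/-- The inclusion `L → K` seen on the twisted copy of `L`. -/
noncomputable def twistedMap : Twisted F L →+* K := (algebraMap L K : L →+* K)

theorem frobenius_pow_apply (n : ℕ) (x : K) :
    (((FiniteField.frobeniusAlgHom F K).toLinearMap : Module.End F K) ^ n) x =
      x ^ (Fintype.card F ^ n) := by
  induction n generalizing x with
  | zero => simp
  | succ n ih =>
    rw [pow_succ, Module.End.mul_apply, ih, AlgHom.toLinearMap_apply,
      FiniteField.coe_frobeniusAlgHom, ← pow_mul, ← pow_succ']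

/-- An Ore polynomial `∑ aᵢ τⁱ` acts on an extension `K` of `L` as `x ↦ ∑ aᵢ x ^ (q ^ i)`. -/
noncomputable def act : Ore F L →+* Module.End F K :=
  SkewMonoidAlgebra.liftNCRingHom
    ((Algebra.lmul F K : K →+* Module.End F K).comp (twistedMap K))
    (powersHom (Module.End F K) (FiniteField.frobeniusAlgHom F K).toLinearMap)
    (by
      intro x y
      refine LinearMap.ext fun z => ?_
      simp only [RingHom.comp_apply, Module.End.mul_apply, powersHom_apply, frobenius_pow_apply,
        RingHom.coe_coe, Algebra.coe_lmul_eq_mul, LinearMap.mul_apply', mul_pow,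
        Twisted.smul_eq_pow]
      rw [map_pow])

theorem act_monomial (n : ℕ) (r : Twisted F L) (x : K) :
    act K (SkewPolynomial.monomial n r : Ore F L) x =
      twistedMap K r * x ^ (Fintype.card F ^ n) := by
  have : act K (SkewPolynomial.monomial n r : Ore F L) =
      ((Algebra.lmul F K : K →+* Module.End F K).comp (twistedMap K)) r *
      (powersHom (Module.End F K) (FiniteField.frobeniusAlgHom F K).toLinearMap)
        (Multiplicative.ofAdd n) :=
    SkewMonoidAlgebra.liftNC_single _ _ _ _
  rw [this]
  simp only [RingHom.comp_apply, Module.End.mul_apply, powersHom_apply, frobenius_pow_apply,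
    RingHom.coe_coe, Algebra.coe_lmul_eq_mul, LinearMap.mul_apply', _root_.toAdd_ofAdd]

/-- The `q`-polynomial over `K` that gives the action of an Ore polynomial. -/
noncomputable def toPoly (P : Ore F L) : K[X] :=
  ∑ n ∈ P.support, C (twistedMap K (SkewPolynomial.coeff P n)) * X ^ (Fintype.card F ^ n)

theorem eval_toPoly (P : Ore F L) (x : K) : (toPoly K P).eval x = act K P x := by
  conv_rhs => rw [← SkewPolynomial.sum_monomial P, SkewPolynomial.sum_def]
  rw [map_sum, LinearMap.sum_apply, toPoly, eval_finsetSum]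
  refine Finset.sum_congr rfl fun n _ => ?_
  rw [act_monomial]
  simp

theorem coeff_toPoly (P : Ore F L) (n : ℕ) :
    (toPoly K P).coeff (Fintype.card F ^ n) = twistedMap K (SkewPolynomial.coeff P n) := by
  classical
  rw [toPoly, finsetSum_coeff, Finset.sum_eq_single n]
  · simp
  · intro m _ hm
    rw [coeff_C_mul_X_pow, if_neg]
    exact fun h => hm (Nat.pow_right_injective (Fintype.one_lt_card (α := F)) h).symm
  · intro h
    simp [SkewPolynomial.notMem_support_iff.mp h]

theorem natDegree_toPoly_le (P : Ore F L) :
    (toPoly K P).natDegree ≤ Fintype.card F ^ P.tauDegree := by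
  refine natDegree_sum_le_of_forall_le _ _ fun n hn => ?_
  refine (natDegree_C_mul_X_pow_le _ _).trans (Nat.pow_le_pow_right Fintype.card_pos ?_)
  exact le_tauDegree (SkewPolynomial.mem_support_iff.mp hn)

theorem toPoly_ne_zero {P : Ore F L} (hP : P ≠ 0) : toPoly K P ≠ 0 := by
  intro h
  have := coeff_toPoly K P P.tauDegree
  rw [h, coeff_zero] at this
  exact coeff_tauDegree_ne_zero hP ((map_eq_zero (twistedMap K)).mp this.symm)

theorem natDegree_toPoly {P : Ore F L} (hP : P ≠ 0) :
    (toPoly K P).natDegree = Fintype.card F ^ P.tauDegree := by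
  refine le_antisymm (natDegree_toPoly_le K P) (le_natDegree_of_ne_zero ?_)
  rw [coeff_toPoly]
  exact fun h => coeff_tauDegree_ne_zero hP ((map_eq_zero (twistedMap K)).mp h)

theorem card_cast_eq_zero : (Fintype.card F : K) = 0 := by
  rw [← map_natCast (algebraMap F K), FiniteField.cast_card_eq_zero, map_zero]

/-- Since `q = 0` in `K`, only the linear term survives. A nonzero constant coefficient therefore
makes the derivative a unit, and the `q`-polynomial separable. -/
theorem derivative_toPoly (P : Ore F L) :
    derivative (toPoly K P) = C (twistedMap K (SkewPolynomial.coeff P 0)) := by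
  rw [toPoly, derivative_sum, Finset.sum_eq_single 0]
  · simp
  · intro m _ hm
    rw [derivative_C_mul_X_pow, Nat.cast_pow, card_cast_eq_zero (F := F) K, zero_pow hm]
    simp
  · intro h
    simp [SkewPolynomial.notMem_support_iff.mp h]

theorem separable_toPoly {P : Ore F L} (hP : SkewPolynomial.coeff P 0 ≠ 0) :
    (toPoly K P).Separable := by
  rw [Polynomial.Separable, derivative_toPoly]
  obtain ⟨u, hu⟩ := isUnit_C.mpr ((_root_.map_ne_zero (twistedMap K)).mpr hP).isUnit
  exact ⟨0, ↑u⁻¹, by rw [← hu]; simp⟩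

theorem ker_act_eq {P : Ore F L} (hP : P ≠ 0) :
    (LinearMap.ker (act K P) : Set K) = (toPoly K P).rootSet K := by
  ext x
  rw [mem_rootSet_of_ne (toPoly_ne_zero K hP), coe_aeval_eq_eval, eval_toPoly]
  rfl

theorem card_ker_act [IsAlgClosed K] {P : Ore F L} (hP : SkewPolynomial.coeff P 0 ≠ 0) :
    Nat.card (LinearMap.ker (act K P)) = Fintype.card F ^ P.tauDegree := by
  have hP0 : P ≠ 0 := by
    rintro rfl
    exact hP rfl
  have h1 : Nat.card (LinearMap.ker (act K P)) = Nat.card ((toPoly K P).rootSet K) := by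
    rw [← ker_act_eq K hP0]
    rfl
  rw [h1, Nat.card_eq_fintype_card, card_rootSet_eq_natDegree (separable_toPoly K hP)
    (IsAlgClosed.splits _), natDegree_toPoly K hP0]

/-- An Ore polynomial that kills the kernel of a separable `D` is a left multiple of `D`. -/
theorem exists_eq_mul_of_ker_le [IsAlgClosed K] {D : Ore F L}
    (hD : SkewPolynomial.coeff D 0 ≠ 0) {P : Ore F L}
    (h : LinearMap.ker (act K D) ≤ LinearMap.ker (act K P)) : ∃ Q, P = Q * D := by
  have hD0 : D ≠ 0 := by
    rintro rfl
    exact hD rfl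
  obtain ⟨Q, R, hPQ, hR⟩ := exists_eq_mul_add hD0 P
  refine ⟨Q, ?_⟩
  by_contra hne
  have hR0 : R ≠ 0 := by
    rintro rfl
    exact hne (by rw [hPQ, add_zero])
  have hlt : R.tauDegree < D.tauDegree := hR.resolve_left hR0
  -- The remainder still kills the `q ^ deg D` elements of `ker D`, too many zeros for a nonzero
  -- `q`-polynomial of smaller degree.
  have hle : LinearMap.ker (act K D) ≤ LinearMap.ker (act K R) := by
    intro x hx
    have hx' := h hx
    rw [LinearMap.mem_ker] at hx hx' ⊢
    rw [hPQ, map_add, map_mul, LinearMap.add_apply, Module.End.mul_apply, hx, map_zero,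
      zero_add] at hx'
    exact hx'
  have hfin : Finite (LinearMap.ker (act K R)) := by
    have : Finite ((toPoly K R).rootSet K) := inferInstance
    rw [← ker_act_eq K hR0] at this
    exact this
  have hcard : Nat.card (LinearMap.ker (act K R)) ≤ Fintype.card F ^ R.tauDegree := by
    have h1 : Nat.card (LinearMap.ker (act K R)) = Nat.card ((toPoly K R).rootSet K) := by
      rw [← ker_act_eq K hR0]
      rfl
    rw [h1, ← natDegree_toPoly K hR0]
    exact ncard_rootSet_le _ _
  have h2 := Nat.card_mono (t := (LinearMap.ker (act K R) : Set K)) (Set.toFinite _) hle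
  have h3 : Nat.card (LinearMap.ker (act K D)) ≤ Nat.card (LinearMap.ker (act K R)) := h2
  rw [card_ker_act K hD] at h3
  exact absurd (h3.trans hcard)
    (not_le.mpr (Nat.pow_lt_pow_right (Fintype.one_lt_card (α := F)) hlt))

end Action

end Ore

/-! ### Indices of ideals and sizes of modules over a Dedekind domain -/

section Dedekind

theorem Submodule.card_eq_card_mul_card_quotient {R M : Type*} [Ring R] [AddCommGroup M]
    [Module R M] (N : Submodule R M) : Nat.card M = Nat.card N * Nat.card (M ⧸ N) := by
  rw [mul_comm]
  exact AddSubgroup.card_eq_card_quotient_mul_card_addSubgroup N.toAddSubgroup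

variable {A : Type*} [CommRing A] [IsDedekindDomain A]

/-- The module `I / IJ` is generated by one element `x`, and `J x ⊆ IJ`, so it is a quotient of `A /
J`. -/
theorem Ideal.card_quotient_mul_le [Ring.HasFiniteQuotients A] {I J : Ideal A} (hI : I ≠ ⊥)
    (hJ : J ≠ ⊥) : Nat.card (A ⧸ I * J) ≤ Nat.card (A ⧸ I) * Nat.card (A ⧸ J) := by
  have : Finite (A ⧸ J) := Ring.HasFiniteQuotients.finiteQuotient hJ
  obtain ⟨x, hx⟩ := IsDedekindDomain.exists_sup_span_eq (Ideal.mul_le_left (I := I) (J := J))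
    (mul_ne_zero hI hJ)
  have hxI : x ∈ I := hx ▸ Ideal.mem_sup_right (Ideal.mem_span_singleton_self x)
  rw [Submodule.card_eq_card_mul_card_quotient (Submodule.map (I * J).mkQ I), mul_comm,
    Nat.card_congr (Submodule.quotientQuotientEquivQuotient (I * J) I Ideal.mul_le_left).toEquiv]
  refine Nat.mul_le_mul_left _ ?_
  let g : A →ₗ[A] A ⧸ I * J := (I * J).mkQ ∘ₗ LinearMap.toSpanSingleton A A x
  have hg : J ≤ LinearMap.ker g := by
    intro y hy
    change (I * J).mkQ (y • x) = 0
    rw [Submodule.mkQ_apply, Submodule.Quotient.mk_eq_zero, smul_eq_mul, mul_comm y x]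
    exact Ideal.mul_mem_mul hxI hy
  have hrange : LinearMap.range (J.liftQ g hg) = Submodule.map (I * J).mkQ I := by
    rw [Submodule.range_liftQ, LinearMap.range_comp, LinearMap.range_toSpanSingleton]
    have h1 := congrArg (Submodule.map (I * J).mkQ) hx
    rwa [Submodule.map_sup, Submodule.mkQ_map_self, bot_sup_eq] at h1
  rw [← hrange]
  exact Nat.card_le_card_of_surjective _ (LinearMap.surjective_rangeRestrict (J.liftQ g hg))

/-- A finite module over a Dedekind domain has at least as many elements as the quotient of the
ring by its annihilator. -/
theorem Module.card_quotient_annihilator_le [Ring.HasFiniteQuotients A] (V : Type*)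
    [AddCommGroup V] [Module A V] [Finite V] (hV : Module.annihilator A V ≠ ⊥) :
    Nat.card (A ⧸ Module.annihilator A V) ≤ Nat.card V := by
  induction hN : Nat.card V using Nat.strong_induction_on generalizing V with
  | _ N ih =>
  set I := Module.annihilator A V with hI
  by_cases htop : I = ⊤
  · have : Subsingleton (A ⧸ I) := Ideal.Quotient.subsingleton_iff.mpr htop
    rw [Nat.card_of_subsingleton (0 : A ⧸ I), ← hN]
    exact Nat.card_pos
  obtain ⟨P, hP, hIP⟩ := Ideal.exists_le_maximal I htop
  have hP0 : P ≠ ⊥ := fun h => hV (le_bot_iff.mp (h ▸ hIP))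
  obtain ⟨J, hJ⟩ := Ideal.dvd_iff_le.mpr hIP
  have hJ0 : J ≠ ⊥ := by
    rintro rfl
    exact hV (by rw [hJ, Ideal.mul_bot])
  have hJI : ¬ J ≤ I := by
    intro h
    have h1 : P * J = 1 * J := by
      rw [one_mul]
      exact le_antisymm Ideal.mul_le_right (hJ ▸ h)
    exact hP.ne_top (by simpa using mul_right_cancel₀ hJ0 h1)
  -- With `I = PJ` the annihilator, `W = JV` is nonzero and killed by `P`, so it contains a copy of
  -- `A / P`. The quotient `V / W` has annihilator exactly `J`, and induction applies to it.
  let W : Submodule A V := J • ⊤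
  have hPW : ∀ a ∈ P, ∀ w ∈ W, a • w = 0 := by
    intro a ha w hw
    refine Submodule.smul_induction_on hw (fun r hr v _ => ?_) (fun v w hv hw => ?_)
    · rw [← mul_smul]
      have : a * r ∈ I := hJ ▸ Ideal.mul_mem_mul ha hr
      exact Module.mem_annihilator.mp this v
    · rw [smul_add, hv, hw, add_zero]
  obtain ⟨w, hw, hw0⟩ : ∃ w ∈ W, w ≠ 0 := by
    by_contra! hcon
    exact hJI fun a ha => Module.mem_annihilator.mpr fun v =>
      hcon _ (Submodule.smul_mem_smul ha trivial)
  have hcardW : Nat.card (A ⧸ P) ≤ Nat.card W := by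
    let g : A →ₗ[A] W := LinearMap.toSpanSingleton A W ⟨w, hw⟩
    have hg : P ≤ LinearMap.ker g := fun a ha => Subtype.ext (hPW a ha w hw)
    have hker : LinearMap.ker g = P := by
      refine (hP.eq_of_le ?_ hg).symm
      intro h
      have h1 : (1 : A) ∈ LinearMap.ker g := by rw [h]; trivial
      rw [LinearMap.mem_ker, LinearMap.toSpanSingleton_apply, one_smul] at h1
      exact hw0 (congrArg Subtype.val h1)
    refine Nat.card_le_card_of_injective (P.liftQ g hg) ?_
    rw [← LinearMap.ker_eq_bot, Submodule.ker_liftQ, hker, Submodule.mkQ_map_self]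
  have hle : Module.annihilator A (V ⧸ W) ≤ J := by
    intro a ha
    -- If `aV ⊆ W`, then `aP` kills `V`, so `(a)P ⊆ PJ`; cancelling `P` puts `a` in `J`.
    have h1 : Ideal.span {a} * P ≤ J * P := by
      rw [mul_comm J P, ← hJ, Ideal.span_singleton_mul_le_iff]
      intro b hb
      refine Module.mem_annihilator.mpr fun v => ?_
      have h2 : a • v ∈ W := by
        rw [← Submodule.Quotient.mk_eq_zero, Submodule.Quotient.mk_smul]
        exact Module.mem_annihilator.mp ha _
      rw [mul_comm, mul_smul]
      exact hPW b hb _ h2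
    have h3 := Ideal.dvd_iff_le.mpr h1
    rw [mul_dvd_mul_iff_right hP0] at h3
    exact Ideal.dvd_iff_le.mp h3 (Ideal.mem_span_singleton_self a)
  have hann : Module.annihilator A (V ⧸ W) = J := by
    refine le_antisymm hle fun a ha => Module.mem_annihilator.mpr fun v => ?_
    obtain ⟨v, rfl⟩ := Submodule.Quotient.mk_surjective W v
    rw [← Submodule.Quotient.mk_smul, Submodule.Quotient.mk_eq_zero]
    exact Submodule.smul_mem_smul ha trivial
  have hWcard : 1 < Nat.card W := by
    have : Nontrivial W := ⟨⟨⟨w, hw⟩, 0, fun h => hw0 (congrArg Subtype.val h)⟩⟩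
    exact Finite.one_lt_card
  have hVW := Submodule.card_eq_card_mul_card_quotient W
  have : Finite (V ⧸ W) := _root_.Finite.of_surjective _ (Submodule.Quotient.mk_surjective W)
  have hlt : Nat.card (V ⧸ W) < N := by
    rw [← hN, hVW]
    have : 0 < Nat.card (V ⧸ W) := Nat.card_pos
    nlinarith
  have hquot := ih _ hlt (V ⧸ W) (hann ▸ hJ0) rfl
  rw [hann] at hquot
  rw [← hN, hVW, hJ]
  exact (Ideal.card_quotient_mul_le hP0 hJ0).trans (Nat.mul_le_mul hcardW hquot)

/-- A finite subspace that is stable under an action of a Dedekind domain has at least as many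
elements as the quotient of the ring by the ideal that kills it. -/
theorem Module.card_quotient_le_of_forall_mem_iff [Ring.HasFiniteQuotients A] {F V : Type*}
    [CommRing F] [AddCommGroup V] [Module F V] (ρ : A →+* Module.End F V) (S : Submodule F V)
    [Finite S] (hS : ∀ u, ∀ x ∈ S, ρ u x ∈ S) {I : Ideal A} (hI : I ≠ ⊥)
    (hmem : ∀ u, u ∈ I ↔ ∀ x ∈ S, ρ u x = 0) : Nat.card (A ⧸ I) ≤ Nat.card S := by
  let _ : Module A V := Module.compHom V ρ
  let W : Submodule A V :=
    { carrier := S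
      add_mem' := add_mem
      zero_mem' := zero_mem S
      smul_mem' := fun u x hx => hS u x hx }
  have : Finite W := inferInstanceAs (Finite S)
  have hann : Module.annihilator A W = I := by
    ext u
    rw [Module.mem_annihilator, hmem]
    exact ⟨fun hu x hx => congrArg Subtype.val (hu ⟨x, hx⟩),
      fun hu x => Subtype.ext (hu x.1 x.2)⟩
  rw [← hann]
  exact Module.card_quotient_annihilator_le W (hann ▸ hI)

end Dedekind

/-! ### Linear and quadratic relations satisfied by integral elements -/

section IntegralRelations

variable {R K : Type*} [CommRing R] [IsDomain R] [IsIntegrallyClosed R] [CommRing K] [IsDomain K]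
  [Algebra R K] [Module.IsTorsionFree R K]

theorem IsIntegral.dvd_of_mul_eq {z : K} (hz : IsIntegral R z) {c b : R} (hc : c ≠ 0)
    (h : algebraMap R K c * z = algebraMap R K b) : c ∣ b := by
  have h1 : minpoly R z ∣ C c * X - C b :=
    minpoly.isIntegrallyClosed_dvd hz (by simp [h])
  obtain ⟨g, hg⟩ := h1
  have hdeg : (C c * X - C b).natDegree = 1 := by
    rw [sub_eq_add_neg, ← C_neg]
    exact natDegree_linear hc
  have hne : C c * X - C b ≠ 0 := fun h => by simp [h] at hdeg
  have hg0 : g ≠ 0 := by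
    rintro rfl
    exact hne (by rw [hg, mul_zero])
  have hmon := minpoly.monic hz
  have hpos := minpoly.natDegree_pos hz
  have hsum := hmon.natDegree_mul' hg0
  rw [← hg, hdeg] at hsum
  obtain ⟨e, rfl⟩ := natDegree_eq_zero.mp (show g.natDegree = 0 by omega)
  have h1 := congrArg (coeff · 1) hg
  have h0 := congrArg (coeff · 0) hg
  have hlead : (minpoly R z).coeff 1 = 1 := by
    have := hmon.coeff_natDegree
    rwa [show (minpoly R z).natDegree = 1 by omega] at this
  simp [hlead] at h1 h0
  exact ⟨-(minpoly R z).coeff 0, by rw [h1]; linear_combination -h0⟩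

/-- The minimal polynomial over an integrally closed ring divides the quadratic over `R`. It is
monic and not linear, so the cofactor is the constant `e₂`. -/
theorem IsIntegral.dvd_of_quadratic {w : K} (hw : IsIntegral R w) {e₀ e₁ e₂ : R} (he : e₂ ≠ 0)
    (h : algebraMap R K e₂ * w ^ 2 + algebraMap R K e₁ * w + algebraMap R K e₀ = 0)
    (hlin : ∀ b, algebraMap R K b ≠ w) : e₂ ∣ e₁ ∧ e₂ ∣ e₀ := by
  obtain ⟨g, hg⟩ : minpoly R w ∣ C e₂ * X ^ 2 + C e₁ * X + C e₀ :=
    minpoly.isIntegrallyClosed_dvd hw (by simp [h])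
  have hdeg := natDegree_quadratic (b := e₁) (c := e₀) he
  have hg0 : g ≠ 0 := by
    rintro rfl
    rw [mul_zero] at hg
    simp [hg] at hdeg
  have hmon := minpoly.monic hw
  have hpos := minpoly.natDegree_pos hw
  have hne : (minpoly R w).natDegree ≠ 1 := by
    intro h1
    refine hlin (-(minpoly R w).coeff 0) ?_
    have h2 := minpoly.aeval R w
    rw [hmon.as_sum, h1] at h2
    simp at h2
    rw [map_neg]
    linear_combination -h2
  have hsum := hmon.natDegree_mul' hg0
  rw [← hg, hdeg] at hsum
  obtain ⟨e, rfl⟩ := natDegree_eq_zero.mp (show g.natDegree = 0 by omega)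
  have hlead : (minpoly R w).coeff 2 = 1 := by
    have := hmon.coeff_natDegree
    rwa [show (minpoly R w).natDegree = 2 by simp at hsum; omega] at this
  have h2 := congrArg (coeff · 2) hg
  have h1 := congrArg (coeff · 1) hg
  have h0 := congrArg (coeff · 0) hg
  simp [hlead, coeff_C, coeff_X] at h2 h1 h0
  subst h2
  exact ⟨⟨_, h1.trans (mul_comm _ _)⟩, ⟨_, h0.trans (mul_comm _ _)⟩⟩

end IntegralRelations

/-! ### Finite quotients of `F[X]` -/

section FiniteQuotients

variable {F : Type*} [Field F] [Finite F]

instance Polynomial.hasFiniteQuotients : Ring.HasFiniteQuotients F[X] where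
  finiteQuotient {I} hI := by
    obtain ⟨g, rfl⟩ := Submodule.IsPrincipal.principal I
    have hg : g ≠ 0 := by
      rintro rfl
      exact hI (by simp)
    have : Module.Finite F (AdjoinRoot g) := PowerBasis.finite (AdjoinRoot.powerBasis hg)
    exact Module.finite_of_finite F (M := AdjoinRoot g)

theorem Polynomial.card_quotient_span_singleton {g : F[X]} (hg : g ≠ 0) :
    Nat.card (F[X] ⧸ Ideal.span {g}) = Nat.card F ^ g.natDegree := by
  have : Module.Finite F (AdjoinRoot g) := PowerBasis.finite (AdjoinRoot.powerBasis hg)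
  have h := Module.natCard_eq_pow_finrank (K := F) (V := AdjoinRoot g)
  rw [(AdjoinRoot.powerBasis hg).finrank, AdjoinRoot.powerBasis_dim] at h
  exact h

end FiniteQuotients

/-! ### The ring `A_H`: normal form, integral closedness, indices -/

section AH

variable {F : Type*} [Field F] {h f : F[X]}

theorem monic_xi : (xi h f).Monic := by
  unfold xi
  monicity!

theorem natDegree_xi : (xi h f).natDegree = 2 := by
  unfold xi
  compute_degree!

theorem eval₂_xi {R : Type*} [Ring R] (g : F[X] →+* R) (y : R) :
    (xi h f).eval₂ g y = y ^ 2 + g h * y - g f := by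
  simp only [xi, eval₂_sub, eval₂_add, eval₂_mul_X, eval₂_X_pow, eval₂_C]

namespace AH

theorem root_sq : (AdjoinRoot.root (xi h f)) ^ 2 =
    algebraMap F[X] (AH h f) f - algebraMap F[X] (AH h f) h * AdjoinRoot.root (xi h f) := by
  have := AdjoinRoot.eval₂_root (xi h f)
  rw [eval₂_xi] at this
  rw [AdjoinRoot.algebraMap_eq]
  linear_combination this

theorem exists_eq (u : AH h f) : ∃ a b : F[X], u = algebraMap F[X] (AH h f) a +
    algebraMap F[X] (AH h f) b * AdjoinRoot.root (xi h f) := by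
  obtain ⟨g, rfl⟩ := AdjoinRoot.mk_surjective u
  have hlt : (g %ₘ xi h f).natDegree < 2 := by
    have := natDegree_modByMonic_lt g (monic_xi (h := h) (f := f)) (by
      intro h1
      have := natDegree_xi (h := h) (f := f)
      rw [h1] at this
      simp at this)
    rwa [natDegree_xi] at this
  refine ⟨(g %ₘ xi h f).coeff 0, (g %ₘ xi h f).coeff 1, ?_⟩
  have h1 : AdjoinRoot.mk (xi h f) g = AdjoinRoot.mk (xi h f) (g %ₘ xi h f) := by
    conv_lhs => rw [← modByMonic_add_div g (xi h f)]
    simp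
  rw [h1]
  conv_lhs => rw [eq_X_add_C_of_natDegree_le_one (show (g %ₘ xi h f).natDegree ≤ 1 by omega)]
  simp [AdjoinRoot.algebraMap_eq]
  ring

theorem eq_zero_of_add_eq_zero {a b : F[X]} (hab : algebraMap F[X] (AH h f) a +
    algebraMap F[X] (AH h f) b * AdjoinRoot.root (xi h f) = 0) : a = 0 ∧ b = 0 := by
  have h1 : AdjoinRoot.mk (xi h f) (C b * X + C a) = 0 := by
    rw [← hab]
    simp [AdjoinRoot.algebraMap_eq]
    ring
  rw [AdjoinRoot.mk_eq_zero] at h1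
  have h2 : C b * X + C a = 0 := by
    by_contra hne
    have := natDegree_le_of_dvd h1 hne
    rw [natDegree_xi] at this
    exact absurd (this.trans natDegree_linear_le) (by norm_num)
  constructor
  · simpa using congrArg (coeff · 0) h2
  · simpa using congrArg (coeff · 1) h2

noncomputable instance instModuleFinite : Module.Finite F[X] (AH h f) :=
  PowerBasis.finite (AdjoinRoot.powerBasis' monic_xi)

theorem algebraMap_injective : Function.Injective (algebraMap F[X] (AH h f)) := by
  rw [injective_iff_map_eq_zero]
  intro a ha
  exact (eq_zero_of_add_eq_zero (b := 0) (by simpa using ha)).1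

section Domain

variable [IsDomain (AH h f)]

instance instFaithful : FaithfulSMul F[X] (AH h f) :=
  (faithfulSMul_iff_algebraMap_injective _ _).mpr algebraMap_injective

/-- The witness is the conjugate of `c` under `Y ↦ -h - Y`, and the product is the norm. -/
theorem exists_mul_eq {c : AH h f} (hc : c ≠ 0) :
    ∃ (c' : AH h f) (a : F[X]), a ≠ 0 ∧ c * c' = algebraMap F[X] (AH h f) a := by
  obtain ⟨a, b, rfl⟩ := exists_eq c
  set c' := algebraMap F[X] (AH h f) (a - b * h) +
    algebraMap F[X] (AH h f) (-b) * AdjoinRoot.root (xi h f)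
  have hmul : (algebraMap F[X] (AH h f) a + algebraMap F[X] (AH h f) b *
      AdjoinRoot.root (xi h f)) * c' =
      algebraMap F[X] (AH h f) (a ^ 2 - a * b * h - b ^ 2 * f) := by
    simp only [c', map_sub, map_mul, map_neg, map_pow]
    linear_combination -(algebraMap F[X] (AH h f) b) ^ 2 * root_sq (h := h) (f := f)
  refine ⟨c', _, ?_, hmul⟩
  intro h0
  rw [h0, map_zero] at hmul
  have hc' := (mul_eq_zero.mp hmul).resolve_left hc
  obtain ⟨h1, h2⟩ := eq_zero_of_add_eq_zero hc'
  have hb : b = 0 := neg_eq_zero.mp h2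
  have ha : a = 0 := by simpa [hb] using h1
  exact hc (by simp [ha, hb])

/-- Otherwise `(x, a(x))`, with `x` a root of `π`, would be a singular point: differentiating `a² +
h a - f`, which vanishes to order two at `x`, gives the `X`-partial derivative up to a multiple of
`2a + h`. -/
theorem not_dvd_of_smooth (hsmooth : IsSmoothAffineCurve h f) {π a : F[X]} (hπ : Irreducible π)
    (h1 : π ∣ 2 * a + h) : ¬ π ^ 2 ∣ a ^ 2 + h * a - f := by
  rintro ⟨g, hg⟩
  obtain ⟨x, hx⟩ := IsAlgClosed.exists_aeval_eq_zero (AlgebraicClosure F) π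
    (degree_pos_of_irreducible hπ).ne'
  obtain ⟨e, he⟩ := h1
  have h2 := congrArg (aeval x) hg
  have h3 := congrArg (aeval x) he
  have h4 := congrArg (fun r => aeval x (derivative r)) hg
  simp [hx, derivative_pow, map_ofNat (aeval x) 2, map_ofNat (algebraMap F _) 2] at h2 h3 h4
  refine hsmooth x (aeval x a) h2 ⟨h3, ?_⟩
  linear_combination h4 - aeval x (derivative a) * h3

theorem faithfulSMul_fractionField (h f : F[X]) [IsDomain (AH h f)] (K : Type*) [Field K]
    [Algebra (AH h f) K] [IsFractionRing (AH h f) K] [Algebra F[X] K]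
    [IsScalarTower F[X] (AH h f) K] : FaithfulSMul F[X] K := by
  rw [faithfulSMul_iff_algebraMap_injective, IsScalarTower.algebraMap_eq F[X] (AH h f) K]
  exact (IsFractionRing.injective (AH h f) K).comp algebraMap_injective

variable {K : Type*} [Field K] [Algebra (AH h f) K] [IsFractionRing (AH h f) K] [Algebra F[X] K]
  [IsScalarTower F[X] (AH h f) K]

/-- If `π` divides the `Y`-coordinate of the numerator, the claim reduces to `F[X]` being integrally
closed. If not, a Bézout relation normalises the fraction to an integral `w = (a - Y) / π`, whose
quadratic equation forces the divisibilities that smoothness forbids. -/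
theorem mem_range_of_irreducible_mul (hsmooth : IsSmoothAffineCurve h f) {π : F[X]}
    (hπ : Irreducible π) {x : K} (hx : IsIntegral F[X] x) {b : AH h f}
    (hb : algebraMap F[X] K π * x = algebraMap (AH h f) K b) :
    ∃ y, algebraMap (AH h f) K y = x := by
  have := faithfulSMul_fractionField h f K
  have htf : Module.IsTorsionFree F[X] K := inferInstance
  have hinj := IsFractionRing.injective (AH h f) K
  have hπ0 : algebraMap F[X] K π ≠ 0 := by
    rw [Ne, FaithfulSMul.algebraMap_eq_zero_iff]
    exact hπ.ne_zero
  have hinteg : ∀ y : AH h f, IsIntegral F[X] (algebraMap (AH h f) K y) := fun y =>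
    (IsIntegral.of_finite F[X] y).algebraMap
  obtain ⟨b₀, b₁, rfl⟩ := exists_eq b
  have htow : ∀ r : F[X], algebraMap (AH h f) K (algebraMap F[X] (AH h f) r) =
    algebraMap F[X] K r := fun r => (IsScalarTower.algebraMap_apply _ _ _ _).symm
  set Y := AdjoinRoot.root (xi h f)
  rw [map_add, map_mul, htow, htow] at hb
  by_cases hdvd : π ∣ b₁
  · obtain ⟨k, rfl⟩ := hdvd
    have h1 : algebraMap F[X] K π * (x - algebraMap (AH h f) K (algebraMap F[X] _ k * Y)) =
        algebraMap F[X] K b₀ := by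
      rw [map_mul] at hb
      rw [map_mul, htow]
      linear_combination hb
    obtain ⟨r, rfl⟩ := (hx.sub (hinteg _)).dvd_of_mul_eq hπ.ne_zero h1
    have h2 := mul_left_cancel₀ hπ0 (h1.trans (map_mul _ _ _))
    refine ⟨algebraMap F[X] _ r + algebraMap F[X] _ k * Y, ?_⟩
    rw [map_add, htow, ← h2, sub_add_cancel]
  · exfalso
    obtain ⟨s, t, hst⟩ := (hπ.coprime_iff_not_dvd.mpr hdvd : IsCoprime π b₁)
    set w : K := algebraMap F[X] K (-t) * x - algebraMap (AH h f) K (algebraMap F[X] _ s * Y)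
    have hw : IsIntegral F[X] w := (isIntegral_algebraMap.mul hx).sub (hinteg _)
    set a := -t * b₀
    have hw1 : algebraMap F[X] K π * w = algebraMap (AH h f) K (algebraMap F[X] _ a - Y) := by
      have h2 := congrArg (algebraMap F[X] K) hst
      simp only [map_add, map_mul, map_one] at h2
      simp only [w, a, map_sub, map_mul, map_neg, htow]
      linear_combination -(algebraMap F[X] K t) * hb - algebraMap (AH h f) K Y * h2
    have hquad : algebraMap F[X] K (π ^ 2) * w ^ 2 + algebraMap F[X] K (-(π * (2 * a + h))) * w +
        algebraMap F[X] K (a ^ 2 + h * a - f) = 0 := by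
      have h2 : (algebraMap F[X] (AH h f) a - Y) ^ 2 - algebraMap F[X] _ (2 * a + h) *
          (algebraMap F[X] (AH h f) a - Y) + algebraMap F[X] _ (a ^ 2 + h * a - f) = 0 := by
        simp only [map_sub, map_add, map_mul, map_pow, map_ofNat]
        linear_combination root_sq (h := h) (f := f)
      have h3 := congrArg (algebraMap (AH h f) K) h2
      rw [map_add, map_sub, map_mul (algebraMap (AH h f) K) (algebraMap F[X] _ (2 * a + h)), map_pow,
        ← hw1, htow, htow, map_zero] at h3
      rw [map_neg, map_mul (algebraMap F[X] K) π, map_pow]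
      linear_combination h3
    have hlin : ∀ r, algebraMap F[X] K r ≠ w := by
      intro r hr
      rw [← hr, ← htow, ← htow, ← map_mul] at hw1
      have h2 := hinj hw1
      have h3 : algebraMap F[X] (AH h f) (π * r - a) + algebraMap F[X] (AH h f) 1 * Y = 0 := by
        rw [map_sub, map_mul, h2, map_one]
        ring
      exact one_ne_zero (eq_zero_of_add_eq_zero h3).2
    obtain ⟨h2, h3⟩ := hw.dvd_of_quadratic (pow_ne_zero 2 hπ.ne_zero) hquad hlin
    rw [dvd_neg, pow_two, mul_dvd_mul_iff_left hπ.ne_zero] at h2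
    exact not_dvd_of_smooth hsmooth hπ h2 h3

theorem mem_range_of_mul (hsmooth : IsSmoothAffineCurve h f) (a : F[X]) (ha : a ≠ 0) :
    ∀ (x : K) (_ : IsIntegral F[X] x) (b : AH h f)
      (_ : algebraMap F[X] K a * x = algebraMap (AH h f) K b),
    ∃ y, algebraMap (AH h f) K y = x := by
  induction a using UniqueFactorizationMonoid.induction_on_prime with
  | h₁ => exact absurd rfl ha
  | h₂ a hu =>
    intro x _ b hb
    obtain ⟨v, hv⟩ := hu.exists_left_inv
    refine ⟨algebraMap F[X] _ v * b, ?_⟩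
    rw [map_mul, ← hb, ← IsScalarTower.algebraMap_apply, ← mul_assoc, ← map_mul, hv, map_one,
      one_mul]
  | h₃ a π ha0 hπ ih =>
    intro x hx b hb
    rw [map_mul, mul_assoc] at hb
    obtain ⟨y, hy⟩ := mem_range_of_irreducible_mul hsmooth hπ.irreducible
      (isIntegral_algebraMap.mul hx) hb
    exact ih ha0 x hx y hy.symm

theorem isIntegrallyClosed (hsmooth : IsSmoothAffineCurve h f) : IsIntegrallyClosed (AH h f) := by
  rw [isIntegrallyClosed_iff (FractionRing (AH h f))]
  intro x hx
  have hx' : IsIntegral F[X] x := isIntegral_trans x hx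
  obtain ⟨b, c, hc, rfl⟩ := IsFractionRing.div_surjective (A := AH h f) x
  have hc0 : c ≠ 0 := nonZeroDivisors.ne_zero hc
  have hc0' : algebraMap (AH h f) (FractionRing (AH h f)) c ≠ 0 := by
    simpa using hc0
  obtain ⟨c', a, ha, hcc⟩ := exists_mul_eq hc0
  refine mem_range_of_mul hsmooth a ha _ hx' (c' * b) ?_
  rw [IsScalarTower.algebraMap_apply F[X] (AH h f), ← hcc, map_mul, map_mul]
  field_simp

theorem isDedekindDomain [Finite F] (hsmooth : IsSmoothAffineCurve h f) :
    IsDedekindDomain (AH h f) := by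
  have := isIntegrallyClosed hsmooth
  have : Ring.HasFiniteQuotients (AH h f) := .of_module_finite F[X] _
  exact { }

/-- `A_H` is free of rank 2 over `F[X]`, so the norm of `a` is `a ^ 2`. -/
theorem card_quotient_span_singleton [Finite F] {a : F[X]} (ha : a ≠ 0) :
    Nat.card (AH h f ⧸ Ideal.span {algebraMap F[X] (AH h f) a}) =
      Nat.card F ^ (2 * a.natDegree) := by
  have : Ring.HasFiniteQuotients (AH h f) := .of_module_finite F[X] _
  have ha' : algebraMap F[X] (AH h f) a ≠ 0 := by
    rwa [Ne, FaithfulSMul.algebraMap_eq_zero_iff]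
  have : Finite (AH h f ⧸ Ideal.span {algebraMap F[X] (AH h f) a}) :=
    Ring.HasFiniteQuotients.finiteQuotient (by simpa using ha')
  rw [Module.natCard_eq_pow_finrank (K := F),
    finrank_quotient_span_eq_natDegree_norm
      (AdjoinRoot.powerBasis' (monic_xi (h := h) (f := f))).basis ha',
    Algebra.norm_algebraMap_of_basis (AdjoinRoot.powerBasis' (monic_xi (h := h) (f := f))).basis,
    Fintype.card_fin, AdjoinRoot.powerBasis'_dim, natDegree_xi, natDegree_pow]

end Domain

theorem card_quotient_le [Finite F] {p : F[X]} (hp : p ≠ 0) {I : Ideal (AH h f)}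
    (hpI : algebraMap F[X] (AH h f) p ∈ I) (hY : AdjoinRoot.root (xi h f) ∈ I) :
    Nat.card (AH h f ⧸ I) ≤ Nat.card F ^ p.natDegree := by
  rw [← Polynomial.card_quotient_span_singleton hp]
  have : Finite (F[X] ⧸ Ideal.span {p}) :=
    Ring.HasFiniteQuotients.finiteQuotient (by simpa using hp)
  let g : F[X] ⧸ Ideal.span {p} →+* AH h f ⧸ I :=
    Ideal.quotientMap I (algebraMap F[X] (AH h f)) (by
      rw [Ideal.span_singleton_le_iff_mem]
      exact hpI)
  refine Nat.card_le_card_of_surjective g fun u => ?_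
  obtain ⟨u, rfl⟩ := Ideal.Quotient.mk_surjective u
  obtain ⟨a, b, rfl⟩ := exists_eq u
  refine ⟨Ideal.Quotient.mk _ a, ?_⟩
  rw [Ideal.quotientMap_mk, eq_comm, Ideal.Quotient.eq, add_sub_cancel_left]
  exact I.mul_mem_left _ hY

end AH

end AH

/-! ### Fixed points of powers of Frobenius -/

section FiniteFields

theorem ncard_pow_eq_self_le (L : Type*) [Field L] {N : ℕ} (hN : 1 < N) :
    {x : L | x ^ N = x}.ncard ≤ N := by
  have h1 : {x : L | x ^ N = x} = (X ^ N - X : L[X]).rootSet L := by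
    ext x
    rw [mem_rootSet_of_ne (FiniteField.X_pow_card_sub_X_ne_zero L hN)]
    simp [sub_eq_zero]
  rw [h1]
  exact (ncard_rootSet_le _ _).trans (FiniteField.X_pow_card_sub_X_natDegree_eq L hN).le

variable {F L : Type*} [Field F] [Fintype F] [Field L] [Algebra F L]

theorem exists_algebraMap_eq_of_pow_card_eq [Finite L] {x : L}
    (hx : x ^ Fintype.card F = x) : ∃ c, algebraMap F L c = x := by
  have hsub : Set.range (algebraMap F L) ⊆ {x : L | x ^ Fintype.card F = x} := by
    rintro _ ⟨c, rfl⟩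
    change _ ^ _ = _
    rw [← map_pow, FiniteField.pow_card]
  have hcard : (Set.range (algebraMap F L)).ncard = Fintype.card F := by
    rw [← Set.image_univ, Set.ncard_image_of_injective _ (algebraMap F L).injective,
      Set.ncard_univ, Nat.card_eq_fintype_card]
  have heq := Set.eq_of_subset_of_ncard_le hsub
    ((ncard_pow_eq_self_le L Fintype.one_lt_card).trans hcard.ge) (Set.toFinite _)
  exact heq.ge hx

/-- In an extension of odd degree, the field with `q ^ 2` elements meets `L` in `F`. -/
theorem exists_algebraMap_eq_of_odd [FiniteDimensional F L] (hodd : Odd (Module.finrank F L))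
    {x : L} (hx : x ^ (Fintype.card F ^ 2) = x) : ∃ c, algebraMap F L c = x := by
  have : Finite L := Module.finite_of_finite F
  have : Fintype L := Fintype.ofFinite L
  have h1 : ∀ e, x ^ (Fintype.card F ^ (2 * e)) = x := by
    intro e
    induction e with
    | zero => simp
    | succ e ih => rw [mul_add, mul_one, pow_add, pow_mul, ih, hx]
  obtain ⟨e, he⟩ := hodd
  refine exists_algebraMap_eq_of_pow_card_eq ?_
  -- For `d = 2e + 1`, the relations `x ^ (q ^ d) = x` and `x ^ (q ^ (2e)) = x` leave `x ^ q = x`.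
  have h2 := FiniteField.pow_card x
  rwa [Module.card_eq_pow_finrank (K := F) (V := L), he, pow_succ, pow_mul, h1] at h2

variable {p : F[X]} {γ : F[X] →ₐ[F] L}

theorem pow_card_pow_natDegree_eq (hp : Irreducible p) (hγ : RingHom.ker γ = Ideal.span {p})
    (a : F[X]) : γ a ^ (Fintype.card F ^ p.natDegree) = γ a := by
  have hmax : (Ideal.span {p}).IsMaximal := PrincipalIdealRing.isMaximal_of_irreducible hp
  let _ : Field (F[X] ⧸ Ideal.span {p}) := Ideal.Quotient.field _
  have : Finite (F[X] ⧸ Ideal.span {p}) :=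
    Ring.HasFiniteQuotients.finiteQuotient (by simpa using hp.ne_zero)
  let _ : Fintype (F[X] ⧸ Ideal.span {p}) := Fintype.ofFinite _
  have h1 := FiniteField.pow_card (Ideal.Quotient.mk (Ideal.span {p}) a)
  rw [← Nat.card_eq_fintype_card, Polynomial.card_quotient_span_singleton hp.ne_zero, ← map_pow,
    Ideal.Quotient.eq, ← hγ, RingHom.mem_ker, map_sub, map_pow, sub_eq_zero,
    Nat.card_eq_fintype_card] at h1
  exact h1

/-- The image of `γ` has `q ^ deg p` elements, all of them roots of `x ^ (q ^ k) - x`. -/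
theorem natDegree_le_of_forall_pow_eq [Finite L] (hp : Irreducible p)
    (hγ : RingHom.ker γ = Ideal.span {p}) {k : ℕ} (hk : k ≠ 0)
    (h : ∀ a, γ a ^ (Fintype.card F ^ k) = γ a) : p.natDegree ≤ k := by
  have hq : 1 < Fintype.card F := Fintype.one_lt_card
  have h1 : Nat.card γ.range = Fintype.card F ^ p.natDegree := by
    rw [← Nat.card_eq_fintype_card, ← Polynomial.card_quotient_span_singleton hp.ne_zero, ← hγ]
    exact (Nat.card_congr (RingHom.quotientKerEquivRange (γ : F[X] →+* L)).toEquiv).symm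
  have h2 : (γ.range : Set L) ⊆ {x : L | x ^ (Fintype.card F ^ k) = x} := by
    rintro _ ⟨a, rfl⟩
    exact h a
  have h3 := (Set.ncard_le_ncard h2 (Set.toFinite _)).trans
    (ncard_pow_eq_self_le L (Nat.one_lt_pow hk hq))
  have h4 : Fintype.card F ^ p.natDegree ≤ Fintype.card F ^ k := h1 ▸ h3
  exact (Nat.pow_le_pow_iff_right hq).mp h4

end FiniteFields

section Finiteness

variable {F L : Type*} [Field F] [Fintype F] [Field L] [Algebra F L]

theorem Ore.finite_tauDegree_le [Finite L] (N : ℕ) : {P : Ore F L | P.tauDegree ≤ N}.Finite := by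
  have : Finite (Twisted F L) := inferInstanceAs (Finite L)
  refine Set.Finite.of_finite_image (f := fun P (i : Fin (N + 1)) => SkewPolynomial.coeff P i)
    (Set.toFinite _) ?_
  intro P hP Q hQ h
  ext n
  by_cases hn : n ≤ N
  · exact congrFun h ⟨n, by omega⟩
  · simp only [Set.mem_ofPred_eq] at hP hQ
    rw [Ore.coeff_eq_zero (by omega), Ore.coeff_eq_zero (by omega)]

end Finiteness

/-! ### Isogenies of Drinfeld modules in general -/

namespace DrinfeldModule

variable {F L : Type*} [Field F] [Fintype F] [Field L] [Algebra F L]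
variable {γ : F[X] →ₐ[F] L}

/-- Compare the coefficients of `τ ^ k` in `ι φ_a = ψ_a ι`. This restricts the possible orders in
`τ` of an isogeny. -/
theorem pow_card_eq_of_mem_Hom {φ ψ : DrinfeldModule γ} {ι : Ore F L} (hι : ι ∈ Hom φ ψ) {k : ℕ}
    (hk : SkewPolynomial.coeff ι k ≠ 0) (hk' : ∀ i < k, SkewPolynomial.coeff ι i = 0) (a : F[X]) :
    γ a ^ (Fintype.card F ^ k) = γ a := by
  have h1 := Ore.coeff_mul_add_of_vanish (P := ι) (Q := φ a) (b := 0) hk' (by simp)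
  have h2 := Ore.coeff_mul_add_of_vanish (P := ψ a) (Q := ι) (a := 0) (by simp) hk'
  rw [zero_add, ← hι a, pow_zero, pow_one, ψ.coeff_zero] at h2
  rw [add_zero, h2, φ.coeff_zero, mul_comm] at h1
  exact (mul_right_cancel₀ hk h1).symm

/-- If `ι φ_a ∈ L{τ} ι` for all `a`, then `ι` is an isogeny from `φ` to some Drinfeld module. -/
theorem exists_codomain (φ : DrinfeldModule γ) {ι : Ore F L} {k : ℕ}
    (hk : SkewPolynomial.coeff ι k ≠ 0) (hk' : ∀ i < k, SkewPolynomial.coeff ι i = 0)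
    (hγ : ∀ a, γ a ^ (Fintype.card F ^ k) = γ a) (h : ∀ a, ∃ P, ι * φ a = P * ι) :
    ∃ ψ : DrinfeldModule γ, IsIsogeny φ ψ ι := by
  have hι : ι ≠ 0 := by
    rintro rfl
    exact hk rfl
  choose P hP using h
  let Ψ : F[X] →ₐ[F] Ore F L :=
    { toFun := P
      map_one' := mul_right_cancel₀ hι (by rw [← hP, map_one, one_mul, mul_one])
      map_mul' := fun a b => mul_right_cancel₀ hι (by
        rw [← hP, map_mul, ← mul_assoc, hP, mul_assoc, hP, mul_assoc])
      map_zero' := mul_right_cancel₀ hι (by rw [← hP, map_zero, zero_mul, mul_zero])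
      map_add' := fun a b => mul_right_cancel₀ hι (by
        rw [← hP, map_add, mul_add, hP, hP, add_mul])
      commutes' := fun c => mul_right_cancel₀ hι (by
        rw [← hP, AlgHom.commutes, Algebra.commutes]) }
  refine ⟨⟨Ψ, fun a => ?_, ?_⟩, fun a => hP a, hι⟩
  -- The lowest coefficients give constant term `γ(a) ^ (q ^ k)`; `hγ` says that this is `γ(a)`.
  · have h1 := Ore.coeff_mul_add_of_vanish (P := ι) (Q := φ a) (b := 0) hk' (by simp)
    have h2 := Ore.coeff_mul_add_of_vanish (P := P a) (Q := ι) (a := 0) (by simp) hk'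
    rw [zero_add, ← hP a, pow_zero, pow_one] at h2
    rw [add_zero, h2, φ.coeff_zero, mul_comm] at h1
    exact (mul_left_cancel₀ hk h1).trans (hγ a)
  · obtain ⟨a, ha⟩ := φ.exists_tauDegree_pos
    refine ⟨a, ?_⟩
    have ha0 : φ a ≠ 0 := by
      intro h0
      rw [h0, Ore.tauDegree_zero] at ha
      exact lt_irrefl _ ha
    have hPa : P a ≠ 0 := by
      intro h0
      have := hP a
      rw [h0, zero_mul] at this
      exact (mul_ne_zero hι ha0) this
    have h1 := Ore.tauDegree_mul hι ha0
    rw [hP a, Ore.tauDegree_mul hPa hι] at h1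
    change 0 < (P a).tauDegree
    omega

theorem IsIsogeny.tauDegree_eq {φ ψ : DrinfeldModule γ} {ι : Ore F L} (hι : IsIsogeny φ ψ ι)
    (a : F[X]) : (ψ a).tauDegree = (φ a).tauDegree := by
  have h := hι.1 a
  by_cases h0 : φ a = 0
  · rw [h0, mul_zero] at h
    rw [(mul_eq_zero.mp h.symm).resolve_right hι.2, h0]
  · have hψ : ψ a ≠ 0 := by
      intro h1
      rw [h1, zero_mul] at h
      exact mul_ne_zero hι.2 h0 h
    have h1 := Ore.tauDegree_mul hι.2 h0
    rw [h, Ore.tauDegree_mul hψ hι.2] at h1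
    omega

theorem IsIsogeny.comp {φ₁ φ₂ φ₃ : DrinfeldModule γ} {ι₁ ι₂ : Ore F L}
    (h₁ : IsIsogeny φ₁ φ₂ ι₁) (h₂ : IsIsogeny φ₂ φ₃ ι₂) : IsIsogeny φ₁ φ₃ (ι₂ * ι₁) :=
  ⟨fun a => by rw [mul_assoc, h₁.1 a, ← mul_assoc, h₂.1 a, mul_assoc], mul_ne_zero h₂.2 h₁.2⟩

theorem codomain_unique {φ ψ ψ' : DrinfeldModule γ} {ι : Ore F L} (h : IsIsogeny φ ψ ι)
    (h' : IsIsogeny φ ψ' ι) : ψ = ψ' := by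
  ext1
  ext1
  exact mul_right_cancel₀ h.2 ((h.1 X).symm.trans (h'.1 X))

/-- If `g * ι` is a morphism `φ₁ → φ₃` and `ι : φ₁ → φ₂` is an isogeny, then `g` is a morphism
`φ₂ → φ₃`. -/
theorem IsIsogeny.mem_Hom_of_mul {φ₁ φ₂ φ₃ : DrinfeldModule γ} {ι g : Ore F L}
    (h : IsIsogeny φ₁ φ₂ ι) (hg : g * ι ∈ Hom φ₁ φ₃) : g ∈ Hom φ₂ φ₃ := fun a =>
  mul_right_cancel₀ h.2 (by rw [mul_assoc, ← h.1 a, ← mul_assoc, hg a, mul_assoc])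

theorem self_mem_Hom (φ : DrinfeldModule γ) (a : F[X]) : φ a ∈ Hom φ φ := fun b => by
  rw [← map_mul, ← map_mul, mul_comm]

/-- The remainders of the `φ_a` on division by `ι` lie in a finite set, so two of them coincide. -/
theorem exists_mul_eq_self [Finite L] (φ : DrinfeldModule γ) {ι : Ore F L} (hι : ι ≠ 0) :
    ∃ (a : F[X]) (g : Ore F L), a ≠ 0 ∧ φ a = g * ι := by
  choose Q R hQR hR using fun a : F[X] => Ore.exists_eq_mul_add hι (φ a)
  have hmem : ∀ a, R a ∈ {P : Ore F L | P.tauDegree ≤ ι.tauDegree} := by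
    intro a
    rcases hR a with h | h
    · rw [Set.mem_ofPred_eq, h, Ore.tauDegree_zero]
      exact Nat.zero_le _
    · exact h.le
  have := (Ore.finite_tauDegree_le (F := F) (L := L) ι.tauDegree).to_subtype
  obtain ⟨a, b, hab, h⟩ := Finite.exists_ne_map_eq_of_infinite
    fun a => (⟨R a, hmem a⟩ : {P : Ore F L | P.tauDegree ≤ ι.tauDegree})
  refine ⟨a - b, Q a - Q b, sub_ne_zero.mpr hab, ?_⟩
  have h' : R a = R b := congrArg Subtype.val h
  rw [map_sub, hQR a, hQR b, h', sub_mul]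
  abel

theorem HasRank.apply_ne_zero {φ : DrinfeldModule γ} {r : ℕ} (hr : 0 < r) (h : φ.HasRank r)
    {a : F[X]} (ha : a ≠ 0) : φ a ≠ 0 := by
  intro h0
  have h1 := h a
  rw [h0, Ore.tauDegree_zero] at h1
  have h2 : a.natDegree = 0 := by
    rcases Nat.mul_eq_zero.mp h1.symm with h2 | h2
    · omega
    · exact h2
  obtain ⟨c, rfl⟩ := natDegree_eq_zero.mp h2
  have hc : c ≠ 0 := by
    rintro rfl
    exact ha (map_zero _)
  have h3 : φ.toAlgHom (C c) = algebraMap F (Ore F L) c := φ.toAlgHom.commutes c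
  rw [h3] at h0
  exact hc ((map_eq_zero (algebraMap F (Ore F L))).mp h0)

end DrinfeldModule

/-- The fraction `b / a` is a root of the monic polynomial `X ^ j - X ^ i - e`. -/
theorem IsIntegrallyClosed.dvd_of_pow_eq {A : Type*} [CommRing A] [IsDomain A]
    [IsIntegrallyClosed A] {a b e : A} (ha : a ≠ 0) {i j : ℕ} (hij : i < j)
    (h : b ^ j = b ^ i * a ^ (j - i) + a ^ j * e) : a ∣ b := by
  have ha' : algebraMap A (FractionRing A) a ≠ 0 := by simpa using ha
  have hint : IsIntegral A (algebraMap A (FractionRing A) b / algebraMap A (FractionRing A) a) := by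
    refine ⟨X ^ j - (X ^ i + C e), ?_, ?_⟩
    · refine monic_X_pow_sub ((degree_add_le _ _).trans_lt (max_lt ?_ ?_))
      · rw [degree_X_pow]
        exact_mod_cast hij
      · exact degree_C_le.trans_lt (by exact_mod_cast (Nat.zero_le i).trans_lt hij)
    · have h1 := congrArg (algebraMap A (FractionRing A)) h
      simp only [map_add, map_mul, map_pow] at h1
      have h2 : algebraMap A (FractionRing A) a ^ j =
          algebraMap A (FractionRing A) a ^ i * algebraMap A (FractionRing A) a ^ (j - i) := by
        rw [← pow_add, Nat.add_sub_cancel' hij.le]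
      simp only [eval₂_sub, eval₂_add, eval₂_X_pow, eval₂_C, div_pow]
      rw [h1, h2]
      field_simp
      ring
  obtain ⟨y, hy⟩ := IsIntegrallyClosed.isIntegral_iff.mp hint
  refine ⟨y, IsFractionRing.injective A (FractionRing A) ?_⟩
  rw [map_mul, hy, mul_div_cancel₀ _ ha']

/-! ### Rank-two modules: `End(φ)` is `A_H` -/

namespace DrinfeldModule

namespace Rank2

variable {F L : Type*} [Field F] [Fintype F] [Field L] [Algebra F L]
variable {γ : F[X] →ₐ[F] L} {h f : F[X]}

/-- An isogeny intertwines `ξ(φ_X, τ_L)` with `ξ(ψ_X, τ_L)` because `τ_L` is central, and it can be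
cancelled. So every codomain stays in the same class. -/
theorem exists_of_isIsogeny [FiniteDimensional F L] (φ : Rank2 γ h f) {ψ : DrinfeldModule γ}
    {ι : Ore F L} (hι : IsIsogeny φ.toDrinfeldModule ψ ι) :
    ∃ ψ' : Rank2 γ h f, ψ'.toDrinfeldModule = ψ := by
  refine ⟨⟨ψ, fun a => by rw [hι.tauDegree_eq, φ.hasRank], ?_, φ.isFrobeniusCharpoly.2⟩, rfl⟩
  refine mul_right_cancel₀ hι.2 ?_
  have h1 := φ.isFrobeniusCharpoly.1
  rw [eval₂_xi] at h1 ⊢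
  rw [zero_mul, sub_mul, add_mul]
  have hf : (ψ.toAlgHom : F[X] →+* Ore F L) f * ι =
    ι * (φ.toAlgHom : F[X] →+* Ore F L) f := (hι.1 f).symm
  have hh : (ψ.toAlgHom : F[X] →+* Ore F L) h * Ore.tauL F L * ι =
      ι * ((φ.toAlgHom : F[X] →+* Ore F L) h * Ore.tauL F L) := by
    rw [mul_assoc, Ore.tauL_mul, ← mul_assoc, ← mul_assoc]
    exact congrArg (· * _) (hι.1 h).symm
  have ht : Ore.tauL F L ^ 2 * ι = ι * Ore.tauL F L ^ 2 := by
    rw [pow_two, mul_assoc, Ore.tauL_mul, ← mul_assoc, Ore.tauL_mul, mul_assoc]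
  rw [hf, hh, ht, ← mul_add, ← mul_sub, h1, mul_zero]

variable [FiniteDimensional F L]

theorem eval_algebraMap (φ : Rank2 γ h f) (a : F[X]) :
    φ.eval (algebraMap F[X] (AH h f) a) = φ.toDrinfeldModule a :=
  φ.eval_of a

theorem mul_eval (φ ψ : Rank2 γ h f) {ι : Ore F L}
    (hι : ι ∈ Hom φ.toDrinfeldModule ψ.toDrinfeldModule) (u : AH h f) :
    ι * φ.eval u = ψ.eval u * ι := by
  obtain ⟨a, b, rfl⟩ := AH.exists_eq u
  simp only [map_add, map_mul, eval_algebraMap, eval_root]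
  rw [mul_add, add_mul, hι a, ← mul_assoc, hι b, mul_assoc, ← Ore.tauL_mul, mul_assoc]

/-- Parity: `φ_a` has degree `2 deg a`, and `φ_b τ_L` has degree `2 deg b + d` with `d` odd. -/
theorem eval_injective (φ : Rank2 γ h f) (hodd : Odd (Module.finrank F L)) :
    Function.Injective φ.eval := by
  rw [injective_iff_map_eq_zero]
  intro u hu
  obtain ⟨a, b, rfl⟩ := AH.exists_eq u
  simp only [map_add, map_mul, eval_algebraMap, eval_root] at hu
  by_cases hb : b = 0
  · subst hb
    by_cases ha : a = 0
    · simp [ha]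
    · rw [map_zero, zero_mul, add_zero] at hu
      exact absurd hu (φ.hasRank.apply_ne_zero two_pos ha)
  · exfalso
    have hbτ : φ.toDrinfeldModule b * Ore.tauL F L ≠ 0 :=
      mul_ne_zero (φ.hasRank.apply_ne_zero two_pos hb) (Ore.X_pow_ne_zero _)
    have h1 := Ore.tauDegree_mul (φ.hasRank.apply_ne_zero two_pos hb)
      (Ore.X_pow_ne_zero (F := F) (L := L) (Module.finrank F L))
    rw [Ore.tauDegree_X_pow, φ.hasRank] at h1
    have h2 : φ.toDrinfeldModule (-a) = φ.toDrinfeldModule b * Ore.tauL F L := by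
      rw [map_neg]
      exact neg_eq_of_add_eq_zero_right hu
    have h3 := φ.hasRank (-a)
    rw [h2, Ore.tauL, h1] at h3
    obtain ⟨e, he⟩ := hodd
    omega

theorem isDomain (φ : Rank2 γ h f) (hodd : Odd (Module.finrank F L)) : IsDomain (AH h f) :=
  (φ.eval_injective hodd).isDomain φ.eval

section Endomorphisms

/-- Powers of `X` give the even degrees, and their products with `Y` the odd degrees from `d` on. -/
theorem exists_tauDegree_eval_eq (φ : Rank2 γ h f) (hodd : Odd (Module.finrank F L)) {N : ℕ}
    (hN : Module.finrank F L < N) : ∃ v, φ.eval v ≠ 0 ∧ (φ.eval v).tauDegree = N := by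
  have hX : ∀ i : ℕ, (X ^ i : F[X]) ≠ 0 := fun i => pow_ne_zero i X_ne_zero
  obtain ⟨e, he⟩ := hodd
  rcases Nat.even_or_odd' N with ⟨i, hi | hi⟩
  · refine ⟨algebraMap _ _ (X ^ i : F[X]), ?_, ?_⟩
    · rw [eval_algebraMap]
      exact φ.hasRank.apply_ne_zero two_pos (hX i)
    · rw [eval_algebraMap, φ.hasRank, natDegree_X_pow, hi]
  · have h0 := φ.hasRank.apply_ne_zero two_pos (hX (i - e))
    have hτ := Ore.X_pow_ne_zero (F := F) (L := L) (Module.finrank F L)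
    refine ⟨algebraMap _ _ (X ^ (i - e) : F[X]) * AdjoinRoot.root (xi h f), ?_, ?_⟩
    · rw [map_mul, eval_algebraMap, eval_root]
      exact mul_ne_zero h0 hτ
    · rw [map_mul, eval_algebraMap, eval_root, Ore.tauL, Ore.tauDegree_mul h0 hτ, φ.hasRank,
        natDegree_X_pow, Ore.tauDegree_X_pow]
      omega

theorem leadingCoeff_relation (φ : Rank2 γ h f) {u : Ore F L}
    (hu : u ∈ Hom φ.toDrinfeldModule φ.toDrinfeldModule) :
    SkewPolynomial.coeff u u.tauDegree *
        SkewPolynomial.coeff (φ.toDrinfeldModule X) 2 ^ (Fintype.card F ^ u.tauDegree) =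
      SkewPolynomial.coeff (φ.toDrinfeldModule X) 2 *
        SkewPolynomial.coeff u u.tauDegree ^ (Fintype.card F ^ 2) := by
  have hdeg : (φ.toDrinfeldModule X).tauDegree ≤ 2 := by
    rw [φ.hasRank, natDegree_X]
  rw [← Ore.coeff_mul_add_of_le le_rfl hdeg, ← Ore.coeff_mul_add_of_le hdeg le_rfl, hu, add_comm]

theorem coeff_X_two_ne_zero (φ : Rank2 γ h f) :
    SkewPolynomial.coeff (φ.toDrinfeldModule X) 2 ≠ 0 := by
  have h1 := Ore.coeff_tauDegree_ne_zero (φ.hasRank.apply_ne_zero two_pos (X_ne_zero (R := F)))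
  rwa [φ.hasRank, natDegree_X] at h1

/-- Endomorphisms of the same degree have proportional leading coefficients. -/
theorem exists_smul_tauDegree_lt (φ : Rank2 γ h f) (hodd : Odd (Module.finrank F L)) {u v : Ore F L}
    (hu : u ∈ Hom φ.toDrinfeldModule φ.toDrinfeldModule)
    (hv : v ∈ Hom φ.toDrinfeldModule φ.toDrinfeldModule) (hv0 : v ≠ 0)
    (hdeg : u.tauDegree = v.tauDegree) (hpos : 0 < u.tauDegree) :
    ∃ c : F, (u - c • v).tauDegree < u.tauDegree := by
  have hΔ := φ.coeff_X_two_ne_zero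
  have h1 := φ.leadingCoeff_relation hu
  have h2 := φ.leadingCoeff_relation hv
  rw [← hdeg] at h2
  have hv1 : SkewPolynomial.coeff v u.tauDegree ≠ 0 := hdeg ▸ Ore.coeff_tauDegree_ne_zero hv0
  set N := u.tauDegree
  set Δ := SkewPolynomial.coeff (φ.toDrinfeldModule X) 2
  set x := SkewPolynomial.coeff u N
  set y := SkewPolynomial.coeff v N
  -- Both leading coefficients solve the same equation `z Δ ^ (q ^ N) = Δ z ^ (q ^ 2)`, so their
  -- ratio is fixed by the `q²`-Frobenius and lies in `F`.
  have hxy : (x / y) ^ (Fintype.card F ^ 2) = x / y := by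
    rw [div_pow, div_eq_div_iff (pow_ne_zero _ hv1) hv1]
    refine mul_left_cancel₀ hΔ (mul_right_cancel₀ (pow_ne_zero (Fintype.card F ^ N) hΔ) ?_)
    linear_combination -(y * Δ ^ Fintype.card F ^ N) * h1 + (x * Δ ^ Fintype.card F ^ N) * h2
  obtain ⟨c, hc⟩ := exists_algebraMap_eq_of_odd (F := F) (L := L) hodd hxy
  refine ⟨c, Ore.tauDegree_lt hpos fun n hn => ?_⟩
  rw [Ore.coeff_sub, Ore.coeff_smul]
  rcases hn.eq_or_lt with rfl | hn
  · rw [Algebra.smul_def, sub_eq_zero]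
    have hc' : algebraMap F (Twisted F L) c = x / y := hc
    rw [hc', div_mul_cancel₀ x hv1]
  · rw [Ore.coeff_eq_zero hn, Ore.coeff_eq_zero (hdeg ▸ hn), smul_zero, sub_zero]

theorem smul_eval (φ : Rank2 γ h f) (c : F) (v : AH h f) :
    c • φ.eval v = φ.eval (algebraMap F[X] _ (C c) * v) := by
  have h1 : φ.toAlgHom (C c) = algebraMap F (Ore F L) c := φ.toAlgHom.commutes c
  rw [map_mul, eval_algebraMap, h1, Algebra.smul_def]

theorem exists_eval_add (φ : Rank2 γ h f) (hodd : Odd (Module.finrank F L)) (u : Ore F L)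
    (hu : u ∈ Hom φ.toDrinfeldModule φ.toDrinfeldModule) :
    ∃ v r, u = φ.eval v + r ∧ r.tauDegree ≤ Module.finrank F L := by
  induction hN : u.tauDegree using Nat.strong_induction_on generalizing u with
  | _ N ih =>
  by_cases hle : N ≤ Module.finrank F L
  · exact ⟨0, u, by simp, hN ▸ hle⟩
  push Not at hle
  obtain ⟨v, hv0, hv⟩ := φ.exists_tauDegree_eval_eq hodd hle
  obtain ⟨c, hc⟩ := φ.exists_smul_tauDegree_lt hodd hu (φ.eval_mem_hom v) hv0 (hN.trans hv.symm)
    (by omega)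
  obtain ⟨w, r, hw, hr⟩ := ih _ (hN ▸ hc) (u - c • φ.eval v)
    (sub_mem hu (Submodule.smul_mem _ c (φ.eval_mem_hom v))) rfl
  refine ⟨algebraMap F[X] _ (C c) * v + w, r, ?_, hr⟩
  rw [map_add, ← smul_eval, add_assoc, ← hw]
  abel

/-- Any infinite family of endomorphisms has two members that differ by an element of the
image of `A_H`. -/
theorem exists_sub_eq_eval (φ : Rank2 γ h f) (hodd : Odd (Module.finrank F L)) {S : Type*}
    [Infinite S] (e : S → Ore F L)
    (he : ∀ s, e s ∈ Hom φ.toDrinfeldModule φ.toDrinfeldModule) :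
    ∃ s t v, s ≠ t ∧ e s - e t = φ.eval v := by
  have : Finite L := Module.finite_of_finite F
  choose v r hvr hr using fun s => φ.exists_eval_add hodd (e s) (he s)
  have := (Ore.finite_tauDegree_le (F := F) (L := L) (Module.finrank F L)).to_subtype
  obtain ⟨s, t, hst, h⟩ := Finite.exists_ne_map_eq_of_infinite
    fun s => (⟨r s, hr s⟩ : {P : Ore F L | P.tauDegree ≤ Module.finrank F L})
  have h' : r s = r t := congrArg Subtype.val h
  refine ⟨s, t, v s - v t, hst, ?_⟩
  rw [hvr s, hvr t, h', map_sub]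
  abel

theorem range_eval (φ : Rank2 γ h f) (hodd : Odd (Module.finrank F L))
    (hsmooth : IsSmoothAffineCurve h f) :
    Set.range φ.eval = Hom φ.toDrinfeldModule φ.toDrinfeldModule := by
  have hdom := φ.isDomain hodd
  have hclosed := AH.isIntegrallyClosed hsmooth
  have hinj := φ.eval_injective hodd
  refine Set.Subset.antisymm (Set.range_subset_iff.mpr φ.eval_mem_hom) fun u hu => ?_
  have hpow : ∀ k : ℕ, u ^ k ∈ Hom φ.toDrinfeldModule φ.toDrinfeldModule := by
    intro k a
    exact ((show Commute u (φ.toDrinfeldModule a) from hu a).pow_left k).eq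
  -- Pigeonhole on the multiples `φ_a u` makes `u` a fraction `b / a`; pigeonhole on the powers of
  -- `u` then makes it integral. Only commutation of `u` with `φ_a` is available here, not
  -- commutativity of `End(φ)`.
  obtain ⟨s, t, b, hst, hb⟩ := φ.exists_sub_eq_eval hodd
    (fun a : F[X] => φ.toDrinfeldModule a * u) (fun a x => by
      rw [mul_assoc, hu x, ← mul_assoc, φ.self_mem_Hom a x, mul_assoc])
  rw [← sub_mul, ← map_sub, ← eval_algebraMap] at hb
  have ha0 : algebraMap F[X] (AH h f) (s - t) ≠ 0 := by
    rw [Ne, FaithfulSMul.algebraMap_eq_zero_iff]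
    exact sub_ne_zero.mpr hst
  have hcomm : Commute (φ.eval (algebraMap F[X] (AH h f) (s - t))) u := by
    rw [eval_algebraMap]
    exact (hu _).symm
  set a := algebraMap F[X] (AH h f) (s - t)
  obtain ⟨i, j, e, hij, he⟩ : ∃ i j v, i < j ∧ u ^ j - u ^ i = φ.eval v := by
    obtain ⟨i, j, v, hij, hv⟩ := φ.exists_sub_eq_eval hodd (fun k : ℕ => u ^ k) hpow
    rcases lt_or_gt_of_ne hij with hlt | hlt
    · exact ⟨i, j, -v, hlt, by rw [map_neg, ← hv]; abel⟩
    · exact ⟨j, i, v, hlt, hv⟩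
  have hrel : b ^ j = b ^ i * a ^ (j - i) + a ^ j * e := by
    apply hinj
    rw [map_add, map_mul, map_mul, map_pow, map_pow, map_pow, map_pow, ← hb, ← he, hcomm.mul_pow,
      hcomm.mul_pow, mul_sub, mul_assoc, ← (hcomm.pow_pow (j - i) i).eq, ← mul_assoc, ← pow_add,
      Nat.add_sub_cancel' hij.le]
    abel
  obtain ⟨y, rfl⟩ := IsIntegrallyClosed.dvd_of_pow_eq ha0 hij hrel
  rw [map_mul] at hb
  refine ⟨y, (mul_left_cancel₀ ?_ hb).symm⟩
  rw [Ne, map_eq_zero_iff _ hinj]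
  exact ha0

end Endomorphisms

end Rank2

end DrinfeldModule

/-! ### The index of the ideal of an isogeny, and multiplicativity -/

theorem Ideal.card_quotient_le_of_le {A : Type*} [CommRing A] {I J : Ideal A} (h : I ≤ J)
    [Finite (A ⧸ I)] : Nat.card (A ⧸ J) ≤ Nat.card (A ⧸ I) :=
  Nat.card_le_card_of_surjective _ (Ideal.Quotient.factor_surjective h)

theorem Ideal.eq_of_le_of_card_quotient_le {A : Type*} [CommRing A] {I J : Ideal A} (h : I ≤ J)
    [Finite (A ⧸ I)] (hcard : Nat.card (A ⧸ I) ≤ Nat.card (A ⧸ J)) : I = J := by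
  have hsurj := Ideal.Quotient.factor_surjective h
  have hbij := (Nat.bijective_iff_surjective_and_card _).mpr
    ⟨hsurj, le_antisymm hcard (Ideal.card_quotient_le_of_le h)⟩
  refine le_antisymm h fun x hx => ?_
  rw [← Ideal.Quotient.eq_zero_iff_mem]
  refine hbij.1 ?_
  rw [map_zero, Ideal.Quotient.factor_mk]
  exact Ideal.Quotient.eq_zero_iff_mem.mpr hx

namespace DrinfeldModule

namespace Rank2

variable {F L : Type*} [Field F] [Fintype F] [Field L] [Algebra F L] [FiniteDimensional F L]
variable {γ : F[X] →ₐ[F] L} {h f : F[X]}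

/-- The cofactor is automatically a morphism, so membership is mere right divisibility by `ι`. -/
theorem mem_idealOf_iff (φ : Rank2 γ h f) {ψ : DrinfeldModule γ} {ι : Ore F L}
    (hι : IsIsogeny φ.toDrinfeldModule ψ ι) {u : AH h f} :
    u ∈ φ.idealOf ψ ι ↔ ∃ g, φ.eval u = g * ι :=
  ⟨fun ⟨g, _, hg⟩ => ⟨g, hg⟩,
    fun ⟨g, hg⟩ => ⟨g, hι.mem_Hom_of_mul (hg ▸ φ.eval_mem_hom u), hg⟩⟩

theorem idealOf_mul_le (φ₁ φ₂ : Rank2 γ h f) {φ₃ : DrinfeldModule γ} {ι₁ ι₂ : Ore F L}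
    (hι₁ : ι₁ ∈ Hom φ₁.toDrinfeldModule φ₂.toDrinfeldModule) :
    φ₁.idealOf φ₂.toDrinfeldModule ι₁ * φ₂.idealOf φ₃ ι₂ ≤ φ₁.idealOf φ₃ (ι₂ * ι₁) := by
  rw [Ideal.mul_le]
  rintro u ⟨g, hg, hu⟩ v ⟨k, hk, hv⟩
  refine ⟨g * k, fun a => ?_, ?_⟩
  · rw [mul_assoc, hk a, ← mul_assoc, hg a, mul_assoc]
  · rw [map_mul, hu, mul_assoc, φ₁.mul_eval φ₂ hι₁, hv]
    simp only [mul_assoc]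

theorem idealOf_ne_bot (φ : Rank2 γ h f) {ψ : DrinfeldModule γ} {ι : Ore F L}
    (hι : IsIsogeny φ.toDrinfeldModule ψ ι) : φ.idealOf ψ ι ≠ ⊥ := by
  have : Finite L := Module.finite_of_finite F
  obtain ⟨a, g, ha, hg⟩ := φ.toDrinfeldModule.exists_mul_eq_self hι.2
  intro hbot
  have h1 : algebraMap F[X] (AH h f) a ∈ φ.idealOf ψ ι :=
    (φ.mem_idealOf_iff hι).mpr ⟨g, by rw [eval_algebraMap, hg]⟩
  rw [hbot, Ideal.mem_bot] at h1
  exact ha (AH.algebraMap_injective (h1.trans (map_zero _).symm))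

section Separable

variable [IsDedekindDomain (AH h f)] [Ring.HasFiniteQuotients (AH h f)]

/-- `A_H` acts on `ker ι ⊆ K`, and `u` kills this kernel exactly when `ι` divides it on the right.
Thus the ideal is the annihilator of a module with `q ^ deg ι` elements. -/
theorem card_quotient_idealOf_le_of_separable (K : Type*) [Field K] [IsAlgClosed K] [Algebra F K]
    [Algebra L K] [IsScalarTower F L K] (φ : Rank2 γ h f) {ψ : DrinfeldModule γ}
    {ι : Ore F L} (hι : IsIsogeny φ.toDrinfeldModule ψ ι) (hsep : SkewPolynomial.coeff ι 0 ≠ 0) :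
    Nat.card (AH h f ⧸ φ.idealOf ψ ι) ≤ Fintype.card F ^ ι.tauDegree := by
  obtain ⟨ψ, rfl⟩ := φ.exists_of_isIsogeny hι
  have hcard := Ore.card_ker_act K hsep
  have : Finite (LinearMap.ker (Ore.act K ι)) :=
    Nat.finite_of_card_ne_zero (hcard ▸ pow_ne_zero _ Fintype.card_ne_zero)
  rw [← hcard]
  refine Module.card_quotient_le_of_forall_mem_iff ((Ore.act K).comp φ.eval) _ (fun u x hx => ?_)
    (φ.idealOf_ne_bot hι) fun u => ?_
  · rw [LinearMap.mem_ker] at hx ⊢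
    rw [RingHom.comp_apply, ← Module.End.mul_apply, ← map_mul, φ.mul_eval ψ hι.1, map_mul,
      Module.End.mul_apply, hx, map_zero]
  · rw [φ.mem_idealOf_iff hι]
    constructor
    · rintro ⟨g, hg⟩ x hx
      rw [LinearMap.mem_ker] at hx
      rw [RingHom.comp_apply, hg, map_mul, Module.End.mul_apply, hx, map_zero]
    · exact fun hu => Ore.exists_eq_mul_of_ker_le K hsep hu

end Separable

section Frobenius

variable {p : F[X]}

theorem exists_isIsogeny_X_pow (hp : Irreducible p) (hγ : RingHom.ker γ = Ideal.span {p})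
    (φ : DrinfeldModule γ) :
    ∃ ψ : DrinfeldModule γ, IsIsogeny φ ψ (SkewPolynomial.X ^ p.natDegree) := by
  have hvan : ∀ i < p.natDegree,
      SkewPolynomial.coeff (SkewPolynomial.X ^ p.natDegree : Ore F L) i = 0 := by
    intro i hi
    rw [Ore.X_pow_eq, SkewPolynomial.coeff_monomial, if_neg hi.ne']
  refine φ.exists_codomain (k := p.natDegree) ?_ hvan (pow_card_pow_natDegree_eq hp hγ) fun a =>
    Ore.exists_eq_mul_X_pow _ _ (Ore.coeff_mul_of_vanish_left _ hvan)
  rw [Ore.X_pow_eq, SkewPolynomial.coeff_monomial, if_pos rfl]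
  exact one_ne_zero

/-- The order in `τ` of a non-separable morphism is at least the degree of the characteristic. -/
theorem coeff_eq_zero_of_mem_Hom (hp : Irreducible p) (hγ : RingHom.ker γ = Ideal.span {p})
    {φ ψ : DrinfeldModule γ} {ι : Ore F L} (hι : ι ∈ Hom φ ψ)
    (h0 : SkewPolynomial.coeff ι 0 = 0) : ∀ i < p.natDegree, SkewPolynomial.coeff ι i = 0 := by
  have : Finite L := Module.finite_of_finite F
  by_cases hι0 : ι = 0
  · simp [hι0]
  obtain ⟨k, hk, hk'⟩ := Ore.exists_order hι0
  have hk0 : k ≠ 0 := by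
    rintro rfl
    exact hk h0
  have hle := natDegree_le_of_forall_pow_eq hp hγ hk0 (pow_card_eq_of_mem_Hom hι hk hk')
  exact fun i hi => hk' i (hi.trans_le hle)

/-- The ideal contains `Y`, which maps to `τ ^ d`, and `p`: as `γ(p) = 0`, `φ_p` is inseparable and
hence divisible by `τ ^ deg p`. -/
theorem card_quotient_idealOf_X_pow_le (hp : Irreducible p) (hγ : RingHom.ker γ = Ideal.span {p})
    (hdeg : p.natDegree ≤ Module.finrank F L) (φ : Rank2 γ h f) {ψ : DrinfeldModule γ}
    (hι : IsIsogeny φ.toDrinfeldModule ψ (SkewPolynomial.X ^ p.natDegree)) :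
    Nat.card (AH h f ⧸ φ.idealOf ψ (SkewPolynomial.X ^ p.natDegree)) ≤
      Fintype.card F ^ p.natDegree := by
  rw [← Nat.card_eq_fintype_card]
  refine AH.card_quotient_le hp.ne_zero ((φ.mem_idealOf_iff hι).mpr ?_)
    ((φ.mem_idealOf_iff hι).mpr ⟨SkewPolynomial.X ^ (Module.finrank F L - p.natDegree), ?_⟩)
  · rw [eval_algebraMap]
    refine Ore.exists_eq_mul_X_pow _ _
      (coeff_eq_zero_of_mem_Hom hp hγ (φ.self_mem_Hom p) ?_)
    rw [φ.coeff_zero]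
    have : p ∈ RingHom.ker γ := hγ ▸ Ideal.mem_span_singleton_self p
    exact this
  · rw [eval_root, Ore.tauL, ← pow_add, Nat.sub_add_cancel hdeg]

variable [IsDedekindDomain (AH h f)] [Ring.HasFiniteQuotients (AH h f)]

/-- Factors `τ ^ deg p` are split off until `ι` is separable; the index is submultiplicative along
the factorisation. -/
theorem card_quotient_idealOf_le (hp : Irreducible p) (hγ : RingHom.ker γ = Ideal.span {p})
    (hdeg : p.natDegree ≤ Module.finrank F L) (φ : Rank2 γ h f) {ψ : DrinfeldModule γ}
    {ι : Ore F L} (hι : IsIsogeny φ.toDrinfeldModule ψ ι) :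
    Nat.card (AH h f ⧸ φ.idealOf ψ ι) ≤ Fintype.card F ^ ι.tauDegree := by
  induction hN : ι.tauDegree using Nat.strong_induction_on generalizing φ ι with
  | _ N ih =>
  by_cases h0 : SkewPolynomial.coeff ι 0 = 0
  · obtain ⟨φ', hφ'⟩ := exists_isIsogeny_X_pow hp hγ φ.toDrinfeldModule
    obtain ⟨φ', rfl⟩ := φ.exists_of_isIsogeny hφ'
    obtain ⟨ι', rfl⟩ := Ore.exists_eq_mul_X_pow ι p.natDegree
      (coeff_eq_zero_of_mem_Hom hp hγ hι.1 h0)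
    have hι' : IsIsogeny φ'.toDrinfeldModule ψ ι' :=
      ⟨hφ'.mem_Hom_of_mul hι.1, left_ne_zero_of_mul hι.2⟩
    have hadd := Ore.tauDegree_mul hι'.2 hφ'.2
    rw [Ore.tauDegree_X_pow, hN] at hadd
    have hpos := hp.natDegree_pos
    have h1 := φ.idealOf_ne_bot hφ'
    have h2 := φ'.idealOf_ne_bot hι'
    have : Finite (AH h f ⧸ φ.idealOf φ'.toDrinfeldModule (SkewPolynomial.X ^ p.natDegree) *
      φ'.idealOf ψ ι') := Ring.HasFiniteQuotients.finiteQuotient (mul_ne_zero h1 h2)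
    refine (Ideal.card_quotient_le_of_le (φ.idealOf_mul_le φ' hφ'.1)).trans
      ((Ideal.card_quotient_mul_le h1 h2).trans ?_)
    rw [hadd, add_comm, pow_add]
    exact Nat.mul_le_mul (φ.card_quotient_idealOf_X_pow_le hp hγ hdeg hφ')
      (ih _ (by omega) φ' hι' rfl)
  · exact hN ▸ card_quotient_idealOf_le_of_separable (AlgebraicClosure L) φ hι h0

/-- The ideal of an isogeny `ι` has index `q ^ deg ι`. -/
theorem card_quotient_idealOf (hodd : Odd (Module.finrank F L)) (hsmooth : IsSmoothAffineCurve h f)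
    (hp : Irreducible p) (hγ : RingHom.ker γ = Ideal.span {p})
    (hdeg : p.natDegree ≤ Module.finrank F L) (φ : Rank2 γ h f) {ψ : DrinfeldModule γ}
    {ι : Ore F L} (hι : IsIsogeny φ.toDrinfeldModule ψ ι) :
    Nat.card (AH h f ⧸ φ.idealOf ψ ι) = Fintype.card F ^ ι.tauDegree := by
  have : Finite L := Module.finite_of_finite F
  obtain ⟨ψ, rfl⟩ := φ.exists_of_isIsogeny hι
  obtain ⟨a, g, ha, hg⟩ := φ.toDrinfeldModule.exists_mul_eq_self hι.2
  have hg0 : g ≠ 0 := by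
    rintro rfl
    rw [zero_mul] at hg
    exact φ.hasRank.apply_ne_zero two_pos ha hg
  have hgiso : IsIsogeny ψ.toDrinfeldModule φ.toDrinfeldModule g :=
    ⟨hι.mem_Hom_of_mul (hg ▸ φ.self_mem_Hom a), hg0⟩
  have h1 := φ.idealOf_ne_bot hι
  have h2 := ψ.idealOf_ne_bot hgiso
  -- Lower bound: the ideal of `g ι = φ_a` is `(a)`, by `range_eval`, and its index is the product
  -- of the two upper bounds.
  have hle : φ.idealOf ψ.toDrinfeldModule ι * ψ.idealOf φ.toDrinfeldModule g ≤
      Ideal.span {algebraMap F[X] (AH h f) a} := by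
    refine (φ.idealOf_mul_le ψ hι.1).trans ?_
    rintro u ⟨k, hk, hu⟩
    obtain ⟨w, rfl⟩ := (φ.range_eval hodd hsmooth).ge hk
    rw [← hg, ← eval_algebraMap, ← map_mul] at hu
    rw [φ.eval_injective hodd hu]
    exact Ideal.mul_mem_left _ _ (Ideal.mem_span_singleton_self _)
  have : Finite (AH h f ⧸ φ.idealOf ψ.toDrinfeldModule ι * ψ.idealOf φ.toDrinfeldModule g) :=
    Ring.HasFiniteQuotients.finiteQuotient (mul_ne_zero h1 h2)
  have h3 := (Ideal.card_quotient_le_of_le hle).trans (Ideal.card_quotient_mul_le h1 h2)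
  have h4 := Ore.tauDegree_mul hg0 hι.2
  rw [← hg, φ.hasRank] at h4
  rw [AH.card_quotient_span_singleton ha, Nat.card_eq_fintype_card, h4, pow_add, mul_comm] at h3
  have h5 := φ.card_quotient_idealOf_le hp hγ hdeg hι
  have h6 := ψ.card_quotient_idealOf_le hp hγ hdeg hgiso
  have h7 : 0 < Fintype.card F ^ g.tauDegree := pow_pos Fintype.card_pos _
  refine le_antisymm h5 (Nat.le_of_mul_le_mul_right (h3.trans ?_) h7)
  exact Nat.mul_le_mul_left _ h6

theorem idealOf_mul (hodd : Odd (Module.finrank F L)) (hsmooth : IsSmoothAffineCurve h f)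
    (hp : Irreducible p) (hγ : RingHom.ker γ = Ideal.span {p})
    (hdeg : p.natDegree ≤ Module.finrank F L) (φ₁ φ₂ : Rank2 γ h f) {φ₃ : DrinfeldModule γ}
    {ι₁ ι₂ : Ore F L} (h₁ : IsIsogeny φ₁.toDrinfeldModule φ₂.toDrinfeldModule ι₁)
    (h₂ : IsIsogeny φ₂.toDrinfeldModule φ₃ ι₂) :
    φ₁.idealOf φ₃ (ι₂ * ι₁) = φ₁.idealOf φ₂.toDrinfeldModule ι₁ * φ₂.idealOf φ₃ ι₂ := by
  have hne₁ := φ₁.idealOf_ne_bot h₁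
  have hne₂ := φ₂.idealOf_ne_bot h₂
  have : Finite (AH h f ⧸ φ₁.idealOf φ₂.toDrinfeldModule ι₁ * φ₂.idealOf φ₃ ι₂) :=
    Ring.HasFiniteQuotients.finiteQuotient (mul_ne_zero hne₁ hne₂)
  refine (Ideal.eq_of_le_of_card_quotient_le (φ₁.idealOf_mul_le φ₂ h₁.1) ?_).symm
  refine (Ideal.card_quotient_mul_le hne₁ hne₂).trans_eq ?_
  rw [φ₁.card_quotient_idealOf hodd hsmooth hp hγ hdeg h₁,
    φ₂.card_quotient_idealOf hodd hsmooth hp hγ hdeg h₂,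
    φ₁.card_quotient_idealOf hodd hsmooth hp hγ hdeg (h₁.comp h₂), Ore.tauDegree_mul h₂.2 h₁.2,
    pow_add, mul_comm]

end Frobenius

/-! ### From ideals to monic isogenies -/

section Ideals

variable [IsDedekindDomain (AH h f)]

/-- Every nonzero ideal `I` is the ideal of a monic isogeny, which generates the left ideal
`L{τ} I`. -/
theorem exists_monic_isIsogeny (hodd : Odd (Module.finrank F L))
    (hsmooth : IsSmoothAffineCurve h f) (φ : Rank2 γ h f) {I : Ideal (AH h f)} (hI : I ≠ ⊥) :
    ∃ (ψ : DrinfeldModule γ) (ι : Ore F L), ι.Monic ∧ IsIsogeny φ.toDrinfeldModule ψ ι ∧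
      φ.idealOf ψ ι = I ∧ ∀ κ, (∀ u ∈ I, ∃ g, φ.eval u = g * κ) → ∃ g, ι = g * κ := by
  have hinj := φ.eval_injective hodd
  set N : Ideal (Ore F L) := Ideal.span (φ.eval '' I)
  have hmemN : ∀ u ∈ I, φ.eval u ∈ N := fun u hu => Ideal.subset_span ⟨u, hu, rfl⟩
  have hNle : ∀ κ, (∀ u ∈ I, ∃ g, φ.eval u = g * κ) → ∀ P ∈ N, ∃ g, P = g * κ := by
    intro κ hκ P hP
    have h1 : N ≤ Ideal.span {κ} := by
      refine Ideal.span_le.mpr ?_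
      rintro _ ⟨u, hu, rfl⟩
      obtain ⟨g, hg⟩ := hκ u hu
      exact Submodule.mem_span_singleton.mpr ⟨g, hg.symm⟩
    obtain ⟨g, hg⟩ := Submodule.mem_span_singleton.mp (h1 hP)
    exact ⟨g, hg.symm⟩
  have hNmul : ∀ P ∈ N, ∀ a : F[X], P * φ.toDrinfeldModule a ∈ N := by
    intro P hP a
    induction hP using Submodule.span_induction with
    | mem x hx =>
      obtain ⟨u, hu, rfl⟩ := hx
      rw [← eval_algebraMap, ← map_mul]
      exact hmemN _ (I.mul_mem_right _ hu)
    | zero => simp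
    | add x y _ _ hx hy =>
      rw [add_mul]
      exact add_mem hx hy
    | smul r x _ hx =>
      rw [smul_eq_mul, mul_assoc]
      exact N.mul_mem_left _ hx
  have hN : N ≠ ⊥ := by
    obtain ⟨u, hu, hu0⟩ := Submodule.exists_mem_ne_zero_of_ne_bot hI
    intro hbot
    have h1 := hmemN u hu
    rw [hbot, Ideal.mem_bot, map_eq_zero_iff _ hinj] at h1
    exact hu0 h1
  obtain ⟨ι, hιN, hmonic, hgen⟩ := Ore.exists_monic_generator N hN
  have hι0 := hmonic.ne_zero
  obtain ⟨k, hk, hk'⟩ := Ore.exists_order hι0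
  -- Some element of `I` has the same order `k` in `τ` as `ι`, or else all of `L{τ} I` would be
  -- divisible by `τ ^ (k + 1)`. Being an endomorphism, it forces `γ(a) ^ (q ^ k) = γ(a)`, which the
  -- codomain of `ι` needs.
  obtain ⟨u, hu, huk⟩ : ∃ u ∈ I, SkewPolynomial.coeff (φ.eval u) k ≠ 0 := by
    by_contra! hcon
    have hdvd : ∀ u ∈ I, ∃ g, φ.eval u = g * SkewPolynomial.X ^ (k + 1) := by
      intro u hu
      refine Ore.exists_eq_mul_X_pow _ _ fun i hi => ?_
      rcases (Nat.lt_succ_iff.mp hi).eq_or_lt with rfl | hi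
      · exact hcon u hu
      · obtain ⟨g, hg⟩ := hgen _ (hmemN u hu)
        rw [hg]
        exact Ore.coeff_mul_of_vanish_right _ hk' i hi
    obtain ⟨g, hg⟩ := hNle _ hdvd ι hιN
    apply hk
    rw [hg]
    refine Ore.coeff_mul_of_vanish_right g (a := k + 1) (fun i hi => ?_) k (Nat.lt_succ_self k)
    rw [Ore.X_pow_eq, SkewPolynomial.coeff_monomial, if_neg hi.ne']
  have huk' : ∀ i < k, SkewPolynomial.coeff (φ.eval u) i = 0 := by
    obtain ⟨g, hg⟩ := hgen _ (hmemN u hu)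
    rw [hg]
    exact Ore.coeff_mul_of_vanish_right _ hk'
  obtain ⟨ψ, hψ⟩ := φ.exists_codomain hk hk'
    (pow_card_eq_of_mem_Hom (φ.eval_mem_hom u) huk huk') fun a => hgen _ (hNmul ι hιN a)
  refine ⟨ψ, ι, hmonic, hψ, ?_, fun κ hκ => hNle κ hκ ι hιN⟩
  refine le_antisymm (fun w hw => ?_) fun w hw => (φ.mem_idealOf_iff hψ).mpr (hgen _ (hmemN w hw))
  obtain ⟨g, hg⟩ := (φ.mem_idealOf_iff hψ).mp hw
  have hwN : φ.eval w ∈ N := hg ▸ N.mul_mem_left _ hιN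
  obtain ⟨c, hc, hc0⟩ := Submodule.exists_mem_ne_zero_of_ne_bot hI
  -- Inverting `I` up to a principal ideal, `IJ = (c)`: for `w ∈ L{τ} I`, `wJ` lies in `L{τ} c ∩ A_H
  -- = (c)`, because a cofactor of `c` is again an endomorphism. Cancelling `J` gives `w ∈ I`.
  obtain ⟨J, hJ⟩ := Ideal.dvd_iff_le.mpr ((Ideal.span_singleton_le_iff_mem I).mpr hc)
  have hJ0 : J ≠ ⊥ := by
    rintro rfl
    rw [Ideal.mul_bot, Ideal.span_singleton_eq_bot] at hJ
    exact hc0 hJ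
  have hcφ : φ.eval c ≠ 0 := by
    rwa [Ne, map_eq_zero_iff _ hinj]
  have key : Ideal.span {w} * J ≤ I * J := by
    rw [← hJ, Ideal.span_singleton_mul_le_iff]
    intro v hv
    have h1 : ∀ P ∈ N, ∃ g, P * φ.eval v = g * φ.eval c := by
      intro P hP
      induction hP using Submodule.span_induction with
      | mem x hx =>
        obtain ⟨y, hy, rfl⟩ := hx
        have h2 : y * v ∈ Ideal.span {c} := hJ ▸ Ideal.mul_mem_mul hy hv
        obtain ⟨z, hz⟩ := Ideal.mem_span_singleton'.mp h2
        exact ⟨φ.eval z, by rw [← map_mul, ← map_mul, hz]⟩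
      | zero => exact ⟨0, by simp⟩
      | add x y _ _ hx hy =>
        obtain ⟨g, hg⟩ := hx
        obtain ⟨g', hg'⟩ := hy
        exact ⟨g + g', by rw [add_mul, add_mul, hg, hg']⟩
      | smul r x _ hx =>
        obtain ⟨g, hg⟩ := hx
        exact ⟨r * g, by rw [smul_eq_mul, mul_assoc, hg, mul_assoc]⟩
    obtain ⟨g, hg⟩ := h1 _ hwN
    rw [← map_mul] at hg
    have hgEnd : g ∈ Hom φ.toDrinfeldModule φ.toDrinfeldModule :=
      IsIsogeny.mem_Hom_of_mul ⟨φ.eval_mem_hom c, hcφ⟩ (hg ▸ φ.eval_mem_hom _)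
    obtain ⟨z, rfl⟩ := (φ.range_eval hodd hsmooth).ge hgEnd
    rw [← map_mul] at hg
    rw [hinj hg]
    exact Ideal.mul_mem_left _ _ (Ideal.mem_span_singleton_self c)
  have h3 := Ideal.dvd_iff_le.mpr key
  rw [mul_dvd_mul_iff_right hJ0] at h3
  exact Ideal.dvd_iff_le.mp h3 (Ideal.mem_span_singleton_self w)

variable [Ring.HasFiniteQuotients (AH h f)]

theorem bijOn_idealOf {p : F[X]} (hodd : Odd (Module.finrank F L))
    (hsmooth : IsSmoothAffineCurve h f) (hp : Irreducible p)
    (hγ : RingHom.ker γ = Ideal.span {p}) (hdeg : p.natDegree ≤ Module.finrank F L)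
    (φ : Rank2 γ h f) :
    Set.BijOn (fun x : DrinfeldModule γ × Ore F L => φ.idealOf x.1 x.2)
      φ.toDrinfeldModule.monicIsogenies {I : Ideal (AH h f) | I ≠ ⊥} := by
  -- Equal ideals give equal degrees by the index formula, so a right divisor that is also monic is
  -- the whole isogeny.
  have key : ∀ (ψ ψ' : DrinfeldModule γ) (ι κ : Ore F L), ι.Monic → κ.Monic →
      IsIsogeny φ.toDrinfeldModule ψ ι → IsIsogeny φ.toDrinfeldModule ψ' κ →
      φ.idealOf ψ ι = φ.idealOf ψ' κ → (∃ g, ι = g * κ) → ι = κ := by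
    rintro ψ ψ' ι κ hιm hκm hι hκ heq ⟨g, hg⟩
    refine hιm.eq_of_eq_mul hκm hg ?_
    have h1 := φ.card_quotient_idealOf hodd hsmooth hp hγ hdeg hι
    rw [heq, φ.card_quotient_idealOf hodd hsmooth hp hγ hdeg hκ] at h1
    exact (Nat.pow_right_injective (Fintype.one_lt_card (α := F)) h1).symm
  refine ⟨fun x hx => φ.idealOf_ne_bot hx.2, ?_, fun I hI => ?_⟩
  · rintro ⟨ψ₁, ι₁⟩ ⟨hm₁, hi₁⟩ ⟨ψ₂, ι₂⟩ ⟨hm₂, hi₂⟩ heq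
    simp only at hm₁ hi₁ hm₂ hi₂ heq
    obtain ⟨ψ, ι, hm, hi, hideal, hgen⟩ :=
      φ.exists_monic_isIsogeny hodd hsmooth (φ.idealOf_ne_bot hi₁)
    have h1 : ι = ι₁ := key _ _ _ _ hm hm₁ hi hi₁ hideal
      (hgen ι₁ fun u hu => (φ.mem_idealOf_iff hi₁).mp hu)
    have h2 : ι = ι₂ := key _ _ _ _ hm hm₂ hi hi₂ (hideal.trans heq)
      (hgen ι₂ fun u hu => (φ.mem_idealOf_iff hi₂).mp (heq ▸ hu))
    have h3 : ι₁ = ι₂ := h1.symm.trans h2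
    subst h3
    rw [codomain_unique hi₁ hi₂]
  · obtain ⟨ψ, ι, hm, hi, hideal, -⟩ := φ.exists_monic_isIsogeny hodd hsmooth hI
    exact ⟨(ψ, ι), ⟨hm, hi⟩, hideal⟩

end Ideals

end Rank2

end DrinfeldModule

theorem mainTheorem7 {F L : Type*} [Field F] [Fintype F] [Field L] [Algebra F L]
    [FiniteDimensional F L] (hodd : Odd (Module.finrank F L)) (hd : 5 ≤ Module.finrank F L)
    (p : F[X]) (hp_monic : p.Monic) (hp : Irreducible p)
    (γ : F[X] →ₐ[F] L) (hγ : RingHom.ker γ = Ideal.span {p})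
    (m : ℕ) (hm : p.natDegree * m = Module.finrank F L)
    (α : F) (hα : α ≠ 0) (f : F[X]) (hf : f = C α * p ^ m)
    (h : F[X]) (hh : h.natDegree ≤ (Module.finrank F L - 1) / 2)
    (hord : ¬ p ∣ h) (hsmooth : IsSmoothAffineCurve h f) :
    (∀ φ : DrinfeldModule.Rank2 γ h f,
      (Function.Injective φ.eval ∧
        Set.range φ.eval = DrinfeldModule.Hom φ.toDrinfeldModule φ.toDrinfeldModule) ∧
      Set.BijOn (fun x : DrinfeldModule γ × Ore F L => φ.idealOf x.1 x.2)
        φ.toDrinfeldModule.monicIsogenies {I : Ideal (AH h f) | I ≠ ⊥}) ∧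
    (∀ (φ₁ φ₂ φ₃ : DrinfeldModule.Rank2 γ h f) (ι₁ ι₂ : Ore F L),
      DrinfeldModule.IsIsogeny φ₁.toDrinfeldModule φ₂.toDrinfeldModule ι₁ →
      DrinfeldModule.IsIsogeny φ₂.toDrinfeldModule φ₃.toDrinfeldModule ι₂ →
      φ₁.idealOf φ₃.toDrinfeldModule (ι₂ * ι₁) =
        φ₁.idealOf φ₂.toDrinfeldModule ι₁ * φ₂.idealOf φ₃.toDrinfeldModule ι₂) := by
  have hdeg : p.natDegree ≤ Module.finrank F L :=
    Nat.le_of_dvd (by omega) (hm ▸ dvd_mul_right _ _)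
  -- The domain property of `A_H` comes from its embedding in `L{τ}`, so the argument uses a given
  -- `φ`.
  have hstruct : ∀ φ : DrinfeldModule.Rank2 γ h f,
      IsDedekindDomain (AH h f) ∧ Ring.HasFiniteQuotients (AH h f) := by
    intro φ
    have := φ.isDomain hodd
    exact ⟨AH.isDedekindDomain hsmooth, .of_module_finite F[X] _⟩
  refine ⟨fun φ => ⟨⟨φ.eval_injective hodd, φ.range_eval hodd hsmooth⟩, ?_⟩, ?_⟩
  · obtain ⟨_, _⟩ := hstruct φ
    exact φ.bijOn_idealOf hodd hsmooth hp hγ hdeg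
  · intro φ₁ φ₂ φ₃ ι₁ ι₂ h₁ h₂
    obtain ⟨_, _⟩ := hstruct φ₁
    exact φ₁.idealOf_mul hodd hsmooth hp hγ hdeg φ₂ h₁ h₂
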